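/- **Conventions.** A *finite ringed poset* $X$ is a finite poset with a functor $x\mapsto\mathcal O_{X,x}$ from it to commutative rings; $U_x=\{x'\ge x\}$, open sets are the upper sets, and $\mathcal O_X(U)=\lim_{x\in U}\mathcal O_{X,x}$. A morphism $f\colon X\to Y$ is a monotone map with ring maps $f^\sharp_x\colon\mathcal O_{Y,f(x)}\to\mathcal O_{X,x}$ compatible with restrictions. $X$ is *schematic* if all restrictions $\mathcal O_{X,x}\to\mathcal O_{X,y}$ ($x\le y$) are flat and, for all $t\le x,y$, the map $\mathcal O_{X,x}\otimes_{\mathcal O_{X,t}}\mathcal O_{X,y}\to\prod_{z\ge x,y}\mathcal O_{X,z}$ is faithfully flat. A morphism $f\colon X\to Y$ is *schematic* if, for all $x\in X$ and $y\ge f(x)$, the map $\mathcal O_{X,x}\otimes_{\mathcal O_{Y,f(x)}}\mathcal O_{Y,y}\to\prod_{z\in U_x\cap f^{-1}(U_y)}\mathcal O_{X,z}$ induces a surjection on prime spectra. $\mathbf{SchFin}$ is the category of schematic finite ringed posets and schematic morphisms. $X$ is *pseudo-schematic* if its restriction maps are flat epimorphisms of rings. A quasi-coherent module on $X$ is a functorial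 family of $\mathcal O_{X,x}$-modules $M_x$ such that $M_x\otimes_{\mathcal O_{X,x}}\mathcal O_{X,y}\to M_y$ is an isomorphism for all $x\le y$. $X$ is *$\mathbf{Mod}$-affine* if $\pi^*N=(N\otimes_{\mathcal O_X(X)}\mathcal O_{X,x})_x$ and $\pi_*M=\lim_xM_x$ form an adjoint equivalence $\pi^*\dashv\pi_*$ between $\mathcal O_X(X)$-modules and quasi-coherent modules on $X$. A morphism $f\colon X\to Y$ of pseudo-schematic finite ringed posets is a *qc-isomorphism* if $f^{-1}(U_y)$ is $\mathbf{Mod}$-affine for all $y\in Y$ and $\mathcal O_Y\to f_*\mathcal O_X$ is an isomorphism (i.e. $\mathcal O_{Y,y}\to\mathcal O_X(f^{-1}(U_y))$ is an isomorphism for all $y$). A *$\mathbf{SchFin}^{\mathrm{op}}$-datum* $\mathcal X$ is a finite poset $|\mathcal X|$ with a functor $|\mathcal X|\to\mathbf{SchFin}^{\mathrm{op}}$, i.e. spaces $\mathcal X(p)$ and functorial schematic morphisms $\mathcal X_{pq}\colon\mathcal X(q)\to\mathcal X(p)$ for $p\le q$. A morphism $f\colon\mathcal X\to\mathcal Y$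 is a monotone map $f\colon|\mathcal X|\to|\mathcal Y|$ with schematic morphisms $f_p\colon\mathcal X(p)\to\mathcal Y(f(p))$ compatible with the transition morphisms. The *cylinder* $\mathrm{Cyl}(\mathcal X)$ is the finite ringed poset with underlying set $\coprod_p|\mathcal X(p)|$, with $x_p\le y_q$ if and only if $p\le q$ and $x_p\le\mathcal X_{pq}(y_q)$, with stalks $\mathcal O_{\mathcal X(p),x_p}$, and with restriction maps $\mathcal O_{\mathcal X(p),x_p}\to\mathcal O_{\mathcal X(p),\mathcal X_{pq}(y_q)}\to\mathcal O_{\mathcal X(q),y_q}$, the second map being $(\mathcal X_{pq})^\sharp_{y_q}$. A morphism $f$ induces $\mathrm{Cyl}(f)\colon\mathrm{Cyl}(\mathcal X)\to\mathrm{Cyl}(\mathcal Y)$, $x_p\mapsto f_p(x_p)$. For an open subset $U\subseteq|\mathcal X|$, $\mathrm{Cyl}(U)$ denotes the cylinder of the datum restricted to $U$. For $p\in|\mathcal X|$ and $q\ge f(p)$ in $|\mathcal Y|$, let $$\rho^f_{pq}\colon\mathrm{Cyl}(U_p\cap f^{-1}(U_q))\to\mathcal X(p)\times_{\mathcal Y(f(p))}\mathcal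 Y(q)$$ be the morphism of ringed posets sending $z_r$ (with $r\ge p$, $f(r)\ge q$) to $(\mathcal X_{pr}(z_r),\mathcal Y_{q\,f(r)}(f_r(z_r)))$, with the induced maps of rings; here the fibred product of ringed posets has as underlying poset the fibred product of posets and as stalks the tensor products $\mathcal O_{\mathcal X(p),x}\otimes_{\mathcal O_{\mathcal Y(f(p)),s}}\mathcal O_{\mathcal Y(q),y}$, where $s$ is the common image of $x$ and $y$. **Theorem.** Let $f\colon\mathcal X\to\mathcal Y$ be a morphism of $\mathbf{SchFin}^{\mathrm{op}}$-data such that $\mathrm{Cyl}(\mathcal X)$ and $\mathrm{Cyl}(\mathcal Y)$ are schematic. Then $\mathrm{Cyl}(f)$ is schematic if and only if, for every $p\in|\mathcal X|$ and every $q\in|\mathcal Y|$ with $q\ge f(p)$, the morphism $\rho^f_{pq}$ is a qc-isomorphism. -/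

import Mathlib

open CategoryTheory CategoryTheory.Limits

universe u v w

/-! ## Categories of data: finite posets with a structure functor -/

/-- A `C`-datum: a finite poset `X` together with a functor `X ⥤ C` (equivalently, a `C`-valued
sheaf on `X` for the topology whose open sets are the upper sets). -/
structure CData (C : Type w) [Category.{v} C] where
  /-- the underlying set of the poset -/
  carrier : Type u
  [order : PartialOrder carrier]
  [fin : Finite carrier]
  /-- the structure functor -/
  sheaf : carrier ⥤ C

namespace CData

section General

variable {C : Type w} [Category.{v} C]

instance : CoeSort (CData.{u} C) (Type u) := ⟨carrier⟩

attribute [instance] order fin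

/-- The value (stalk) of the structure functor at a point. -/
abbrev stalk (X : CData.{u} C) (x : X) : C := X.sheaf.obj x

/-- The restriction morphism `X(x) ⟶ X(y)` for `x ≤ y`. -/
abbrev res (X : CData.{u} C) {x y : X} (h : x ≤ y) : X.stalk x ⟶ X.stalk y :=
  X.sheaf.map (homOfLE h)

theorem res_refl (X : CData.{u} C) {x : X} (h : x ≤ x) : X.res h = 𝟙 (X.stalk x) :=
  X.sheaf.map_id x

theorem res_res (X : CData.{u} C) {x y z : X} (h : x ≤ y) (h' : y ≤ z) :
    X.res h ≫ X.res h' = X.res (h.trans h') :=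
  (X.sheaf.map_comp (homOfLE h) (homOfLE h')).symm

/-- A morphism of `C`-data: a monotone map `f` and a natural transformation `f⁻¹ G ⟶ F`. -/
structure Hom (F G : CData.{u} C) where
  /-- the monotone map on underlying posets -/
  base : F →o G
  /-- the components of the natural transformation -/
  sharp : ∀ x : F, G.stalk (base x) ⟶ F.stalk x
  naturality : ∀ {x y : F} (h : x ≤ y),
    G.res (base.monotone h) ≫ sharp y = sharp x ≫ F.res h

/-- For `f : F ⟶ G` and `x ≤ f(y)`, the composite `G(x) ⟶ G(f(y)) ⟶ F(y)` of the restriction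
and of `f^♯` at `y`. -/
abbrev Hom.toLE {F G : CData.{u} C} (f : Hom F G) {x : G} {y : F} (h : x ≤ f.base y) :
    G.stalk x ⟶ F.stalk y :=
  G.res h ≫ f.sharp y

theorem Hom.sharp_eq {F G : CData.{u} C} (f : Hom F G) {x : F} :
    f.sharp x = f.toLE le_rfl :=
  ((congrArg (· ≫ f.sharp x) (res_refl G le_rfl)).trans (Category.id_comp _)).symm

theorem Hom.eq_of_toLE {F G : CData.{u} C} (f g : Hom F G) (h : ∀ x, f.base x = g.base x)
    (h' : ∀ x, f.sharp x = g.toLE (h x).le) : f = g := by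
  obtain ⟨fb, fs, fn⟩ := f
  obtain ⟨gb, gs, gn⟩ := g
  obtain rfl : fb = gb := OrderHom.ext _ _ (funext h)
  obtain rfl : fs = gs :=
    funext fun x => (h' x).trans ((congrArg (· ≫ gs x) (res_refl G le_rfl)).trans
      (Category.id_comp _))
  rfl

instance : Category (CData.{u} C) where
  Hom := Hom
  id F :=
    { base := OrderHom.id
      sharp := fun x => 𝟙 (F.stalk x)
      naturality := fun _ => (Category.comp_id _).trans (Category.id_comp _).symm }
  comp f g :=
    { base := g.base.comp f.base
      sharp := fun x => g.sharp (f.base x) ≫ f.sharp x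
      naturality := fun {x y} h =>
        have h1 := congrArg (· ≫ f.sharp y) (g.naturality (f.base.monotone h))
        have h2 := congrArg (g.sharp (f.base x) ≫ ·) (f.naturality h)
        ((Category.assoc _ _ _).symm.trans h1).trans
          ((Category.assoc _ _ _).trans (h2.trans (Category.assoc _ _ _).symm)) }
  id_comp f := Hom.eq_of_toLE _ _ (fun _ => rfl) fun x =>
    (Category.comp_id (f.sharp x)).trans f.sharp_eq
  comp_id f := Hom.eq_of_toLE _ _ (fun _ => rfl) fun x =>
    (Category.id_comp (f.sharp x)).trans f.sharp_eq
  assoc f g h := Hom.eq_of_toLE _ _ (fun _ => rfl) fun x =>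
    (Category.assoc (h.sharp (g.base (f.base x))) (g.sharp (f.base x)) (f.sharp x)).symm.trans
      ((congrArg (· ≫ _) (res_refl _ le_rfl)).trans (Category.id_comp _)).symm

theorem base_congr {F G : CData.{u} C} {f g : F ⟶ G} (h : f = g) (x : F) :
    f.base x = g.base x := by rw [h]

theorem sharp_eq_toLE {F G : CData.{u} C} (f : F ⟶ G) (x : F) :
    f.sharp x = f.toLE le_rfl :=
  Hom.sharp_eq f

theorem toLE_id (F : CData.{u} C) {x y : F} (h : x ≤ y) :
    Hom.toLE (𝟙 F : F ⟶ F) h = F.res h :=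
  Category.comp_id _

theorem toLE_congr {F G : CData.{u} C} {f g : F ⟶ G} (e : f = g) {x : G} {y : F}
    (h : x ≤ f.base y) (h' : x ≤ g.base y) : f.toLE h = g.toLE h' := by
  subst e
  rfl

theorem toLE_res {F G : CData.{u} C} (f : F ⟶ G) {x : G} {y z : F}
    (h : x ≤ f.base y) (h' : y ≤ z) :
    f.toLE h ≫ F.res h' = f.toLE (h.trans (f.base.monotone h')) := by
  rw [Hom.toLE, Hom.toLE, Category.assoc, ← f.naturality h', ← Category.assoc, res_res]

theorem res_toLE {F G : CData.{u} C} (f : F ⟶ G) {x x' : G} {y : F}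
    (h : x ≤ x') (h' : x' ≤ f.base y) :
    G.res h ≫ f.toLE h' = f.toLE (h.trans h') := by
  rw [Hom.toLE, Hom.toLE, ← Category.assoc, res_res]

theorem toLE_toLE {F G H : CData.{u} C} (f : F ⟶ G) (g : G ⟶ H) {x : H} {y : G} {z : F}
    (h : x ≤ g.base y) (h' : y ≤ f.base z) :
    g.toLE h ≫ f.toLE h' = (f ≫ g).toLE (h.trans (g.base.monotone h')) := by
  have h1 : g.toLE h ≫ f.toLE h' = (g.toLE h ≫ G.res h') ≫ f.sharp z :=
    (Category.assoc _ _ _).symm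
  rw [h1, toLE_res]
  exact Category.assoc _ _ _

theorem hom_ext {F G : CData.{u} C} (f g : F ⟶ G) (h : ∀ x, f.base x = g.base x)
    (h' : ∀ x, f.sharp x = g.toLE (h x).le) : f = g :=
  Hom.eq_of_toLE f g h h'

/-- The datum induced on a subset (used for open, i.e. upper, subsets). -/
def restrict (X : CData.{u} C) (U : Set X) : CData.{u} C where
  carrier := {x : X // x ∈ U}
  sheaf := Monotone.functor (f := fun x : {x : X // x ∈ U} => x.1) (fun _ _ h => h) ⋙ X.sheaf

/-- The restriction of a morphism `f : X ⟶ Y` to subsets `U`, `V` with `f(U) ⊆ V`. -/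
def restrictHom {X Y : CData.{u} C} (f : X ⟶ Y) (U : Set X) (V : Set Y)
    (h : ∀ x ∈ U, f.base x ∈ V) : X.restrict U ⟶ Y.restrict V where
  base := ⟨fun x => ⟨f.base x.1, h x.1 x.2⟩, fun _ _ hxy => f.base.monotone hxy⟩
  sharp := fun x => f.sharp x.1
  naturality := fun hxy => f.naturality hxy

/-! ### Fibred products -/

section FiberProduct

variable {F G H : CData.{u} C}

theorem fiberProduct_square (f : F ⟶ H) (g : G ⟶ H) {x x' : F} {y y' : G}
    (e : f.base x = g.base y) (e' : f.base x' = g.base y') (hx : x ≤ x') (hy : y ≤ y') :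
    f.sharp x ≫ F.res hx = H.res (f.base.monotone hx) ≫ f.sharp x' ∧
      g.toLE e.le ≫ G.res hy = H.res (f.base.monotone hx) ≫ g.toLE e'.le :=
  ⟨(f.naturality hx).symm, (toLE_res g _ _).trans (res_toLE g _ _).symm⟩

/-- The fibred product `F ×_H G` of `C`-data: the underlying poset is the fibred product of
posets, and the value at `(x, y)` is the pushout of `F(x) ⟵ H(f x) = H(g y) ⟶ G(y)`
(for commutative rings: the tensor product over the common value of `H`). -/
noncomputable def fiberProduct [HasPushouts C] (f : F ⟶ H) (g : G ⟶ H) : CData.{u} C where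
  carrier := {w : F × G // f.base w.1 = g.base w.2}
  sheaf :=
    { obj := fun w => pushout (f.sharp w.1.1) (g.toLE w.2.le)
      map := fun {w w'} k => pushout.map _ _ _ _
        (F.res (leOfHom k).1) (G.res (leOfHom k).2) (H.res (f.base.monotone (leOfHom k).1))
        (fiberProduct_square f g w.2 w'.2 (leOfHom k).1 (leOfHom k).2).1
        (fiberProduct_square f g w.2 w'.2 (leOfHom k).1 (leOfHom k).2).2
      map_id := fun w => by
        apply pushout.hom_ext
        · simp [res_refl]
        · simp [res_refl]
      map_comp := fun {w w' w''} k k' => by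
        apply pushout.hom_ext
        · rw [pushout.inl_desc, pushout.inl_desc_assoc, Category.assoc, pushout.inl_desc,
            ← res_res F (leOfHom k).1 (leOfHom k').1, Category.assoc]
        · rw [pushout.inr_desc, pushout.inr_desc_assoc, Category.assoc, pushout.inr_desc,
            ← res_res G (leOfHom k).2 (leOfHom k').2, Category.assoc] }

/-- The morphism `Z ⟶ F ×_H G` induced by `a : Z ⟶ F` and `b : Z ⟶ G` that agree over `H`. -/
noncomputable def fiberProductLift [HasPushouts C] (f : F ⟶ H) (g : G ⟶ H) {Z : CData.{u} C} (a : Z ⟶ F)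
    (b : Z ⟶ G) (hab : a ≫ f = b ≫ g) : Z ⟶ fiberProduct f g where
  base := ⟨fun z => ⟨(a.base z, b.base z), base_congr hab z⟩,
    fun _ _ h => ⟨a.base.monotone h, b.base.monotone h⟩⟩
  sharp := fun z => pushout.desc (a.sharp z) (b.sharp z) (by
    exact (sharp_eq_toLE (a ≫ f) z).trans
      ((toLE_congr hab _ _).trans (Category.assoc _ _ _).symm))
  naturality := fun {z z'} h => by
    apply pushout.hom_ext
    · exact (pushout.inl_desc_assoc _ _ _ _).trans (((Category.assoc _ _ _).trans
        (congrArg (_ ≫ ·) (pushout.inl_desc _ _ _))).trans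
        ((a.naturality h).trans (pushout.inl_desc_assoc _ _ _ _).symm))
    · exact (pushout.inr_desc_assoc _ _ _ _).trans (((Category.assoc _ _ _).trans
        (congrArg (_ ≫ ·) (pushout.inr_desc _ _ _))).trans
        ((b.naturality h).trans (pushout.inr_desc_assoc _ _ _ _).symm))

end FiberProduct

/-! ### The cylinder -/

/-- The transition morphism `𝒳(q) ⟶ 𝒳(p)` for `p ≤ q` of a datum with values in the opposite of
the category of `C`-data. -/
abbrev trans (X : CData.{u} (CData.{u} C)ᵒᵖ) {p q : X} (h : p ≤ q) :
    (X.stalk q).unop ⟶ (X.stalk p).unop :=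
  (X.res h).unop

theorem trans_refl (X : CData.{u} (CData.{u} C)ᵒᵖ) {p : X} (h : p ≤ p) :
    X.trans h = 𝟙 _ := by
  rw [trans, res_refl]
  rfl

theorem trans_trans (X : CData.{u} (CData.{u} C)ᵒᵖ) {p q r : X} (h : p ≤ q) (h' : q ≤ r) :
    X.trans h' ≫ X.trans h = X.trans (h.trans h') := by
  rw [trans, trans, trans, ← res_res X h h']
  rfl

/-- The component `𝒳(p) ⟶ 𝒴(f(p))` of a morphism `f : 𝒳 ⟶ 𝒴`. -/
abbrev component {X Y : CData.{u} (CData.{u} C)ᵒᵖ} (f : X ⟶ Y) (p : X) :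
    (X.stalk p).unop ⟶ (Y.stalk (f.base p)).unop :=
  (f.sharp p).unop

theorem component_naturality {X Y : CData.{u} (CData.{u} C)ᵒᵖ} (f : X ⟶ Y) {p q : X}
    (h : p ≤ q) :
    X.trans h ≫ component f p = component f q ≫ Y.trans (f.base.monotone h) :=
  congrArg Quiver.Hom.unop (f.naturality h).symm

/-- The points of the cylinder: the disjoint union of the underlying sets of the `𝒳(p)`. -/
structure CylPt (X : CData.{u} (CData.{u} C)ᵒᵖ) where
  /-- the index -/
  idx : X
  /-- the point of `𝒳(idx)` -/
  pt : (X.stalk idx).unop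

instance (X : CData.{u} (CData.{u} C)ᵒᵖ) : Finite (CylPt X) :=
  Finite.of_injective
    (fun a : CylPt X => (⟨a.idx, a.pt⟩ : Σ p : X, ((X.stalk p).unop : Type u)))
    (fun a b h => by
      cases a
      cases b
      cases h
      rfl)

/-- `x_p ≤ y_q` if and only if `p ≤ q` and `x_p ≤ 𝒳_{pq}(y_q)` in `𝒳(p)`. -/
instance (X : CData.{u} (CData.{u} C)ᵒᵖ) : PartialOrder (CylPt X) where
  le a b := ∃ h : a.idx ≤ b.idx, a.pt ≤ (X.trans h).base b.pt
  le_refl a := ⟨le_rfl, by rw [trans_refl]; exact le_rfl⟩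
  le_trans a b c := by
    rintro ⟨h, k⟩ ⟨h', k'⟩
    refine ⟨h.trans h', k.trans ?_⟩
    rw [← trans_trans X h h']
    exact (X.trans h).base.monotone k'
  le_antisymm a b := by
    rintro ⟨h, k⟩ ⟨h', k'⟩
    obtain ⟨p, x⟩ := a
    obtain ⟨q, y⟩ := b
    obtain rfl : p = q := le_antisymm h h'
    rw [trans_refl] at k k'
    exact congrArg (CylPt.mk p) (le_antisymm k k')

/-- The cylinder of a datum `𝒳` of `C`-data: its value at `x_p` is `𝒳(p)(x_p)`, and the
restriction along `x_p ≤ y_q` is the restriction `𝒳(p)(x_p) ⟶ 𝒳(p)(𝒳_{pq}(y_q))` followed by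
`(𝒳_{pq})^♯ : 𝒳(p)(𝒳_{pq}(y_q)) ⟶ 𝒳(q)(y_q)`. -/
def cyl (X : CData.{u} (CData.{u} C)ᵒᵖ) : CData.{u} C where
  carrier := CylPt X
  sheaf :=
    { obj := fun a => (X.stalk a.idx).unop.stalk a.pt
      map := fun k => (X.trans (leOfHom k).1).toLE (leOfHom k).2
      map_id := fun a => (toLE_congr (trans_refl X le_rfl) _ (le_refl a.pt)).trans
        ((toLE_id _ _).trans (res_refl _ _))
      map_comp := fun k k' =>
        (toLE_congr (trans_trans X (leOfHom k).1 (leOfHom k').1).symm _ _).trans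
          (toLE_toLE _ _ (leOfHom k).2 (leOfHom k').2).symm }

/-- The morphism of cylinders induced by a morphism of data: `x_p ↦ f_p(x_p)`. -/
def cylMap {X Y : CData.{u} (CData.{u} C)ᵒᵖ} (f : X ⟶ Y) : cyl X ⟶ cyl Y where
  base :=
    { toFun := fun a => (⟨f.base a.idx, (component f a.idx).base a.pt⟩ : CylPt Y)
      monotone' := fun a b hab =>
        ⟨f.base.monotone hab.1, ((component f a.idx).base.monotone hab.2).trans
          (base_congr (component_naturality f hab.1) b.pt).le⟩ }
  sharp := fun a => (component f a.idx).sharp a.pt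
  naturality := fun {a b} hab => by
    refine (congrArg (_ ≫ ·) (sharp_eq_toLE (component f b.idx) b.pt)).trans
      (Eq.trans ?_ (congrArg (· ≫ _) (sharp_eq_toLE (component f a.idx) a.pt)).symm)
    exact (toLE_toLE (component f b.idx) (Y.trans (f.base.monotone hab.1)) _ _).trans
      ((toLE_congr (component_naturality f hab.1).symm _ _).trans
        (toLE_toLE (X.trans hab.1) (component f a.idx) _ hab.2).symm)

/-- The projection `Cyl(𝒳|_U) ⟶ 𝒳(p)`, for `U` contained in `U_p = {r | p ≤ r}`; on `𝒳(r)` it is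
the transition morphism `𝒳(r) ⟶ 𝒳(p)`. -/
def cylProj (X : CData.{u} (CData.{u} C)ᵒᵖ) (U : Set X) (p : X) (hU : ∀ r ∈ U, p ≤ r) :
    cyl (X.restrict U) ⟶ (X.stalk p).unop where
  base :=
    { toFun := fun a => (X.trans (hU a.idx.1 a.idx.2)).base a.pt
      monotone' := fun a b hab =>
        ((X.trans (hU a.idx.1 a.idx.2)).base.monotone hab.2).trans
          (base_congr (trans_trans X (hU a.idx.1 a.idx.2) hab.1) b.pt).le }
  sharp := fun a => (X.trans (hU a.idx.1 a.idx.2)).sharp a.pt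
  naturality := fun {a b} hab => by
    refine Eq.trans ?_ (congrArg (· ≫ _)
      (sharp_eq_toLE (X.trans (hU a.idx.1 a.idx.2)) a.pt)).symm
    exact (toLE_congr (trans_trans X (hU a.idx.1 a.idx.2) hab.1).symm _ _).trans
      (toLE_toLE (X.trans hab.1) (X.trans (hU a.idx.1 a.idx.2)) _ hab.2).symm

section Rho

variable {X Y : CData.{u} (CData.{u} C)ᵒᵖ} (f : X ⟶ Y) (p : X) (q : Y)

/-- The open subset `U_p ∩ f⁻¹(U_q)` of the underlying poset of `𝒳`. -/
def capPreimage : Set X := {r | p ≤ r ∧ q ≤ f.base r}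

/-- The morphism `Cyl(U_p ∩ f⁻¹(U_q)) ⟶ Cyl(U_p) ⟶ 𝒳(p)`. -/
def rhoFst : cyl (X.restrict (capPreimage f p q)) ⟶ (X.stalk p).unop :=
  cylProj X (capPreimage f p q) p (fun _ hr => hr.1)

/-- The morphism `Cyl(U_p ∩ f⁻¹(U_q)) ⟶ Cyl(U_q) ⟶ 𝒴(q)` induced by `f`. -/
def rhoSnd : cyl (X.restrict (capPreimage f p q)) ⟶ (Y.stalk q).unop :=
  cylMap (restrictHom f (capPreimage f p q) (Set.Ici q) (fun _ hr => hr.2)) ≫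
    cylProj Y (Set.Ici q) q (fun _ hr => hr)

theorem rho_comm (h : f.base p ≤ q) :
    rhoFst f p q ≫ component f p = rhoSnd f p q ≫ Y.trans h := by
  have key : ∀ a : CylPt (X.restrict (capPreimage f p q)),
      X.trans a.idx.2.1 ≫ component f p =
        (component f a.idx.1 ≫ Y.trans a.idx.2.2) ≫ Y.trans h := fun a => by
    rw [component_naturality, Category.assoc, trans_trans]
  refine hom_ext _ _ (fun a => base_congr (key a) a.pt) (fun a => ?_)
  exact (sharp_eq_toLE (X.trans a.idx.2.1 ≫ component f p) a.pt).trans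
    (toLE_congr (key a) _ _)

/-- For `q ≥ f(p)`, the morphism
`ρ_{pq} : Cyl(U_p ∩ f⁻¹(U_q)) ⟶ 𝒳(p) ×_{𝒴(f(p))} 𝒴(q)`. -/
noncomputable def rho [HasPushouts C] (h : f.base p ≤ q) :
    cyl (X.restrict (capPreimage f p q)) ⟶ fiberProduct (component f p) (Y.trans h) :=
  fiberProductLift (component f p) (Y.trans h) (rhoFst f p q) (rhoSnd f p q) (rho_comm f p q h)

end Rho

end General

end CData

/-! ## Ringed posets and schematic spaces -/

/-- Finite ringed posets: finite posets with a structure functor to commutative rings. -/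
abbrev RingedPoset : Type (u + 1) := CData.{u} CommRingCat.{u}

/-- The ring homomorphism `A ⊗_R B → ∏ i, D i` induced by compatible families of homomorphisms
`A → D i` and `B → D i`; the tensor product is the pushout of commutative rings. -/
noncomputable def tensorToProd {R A B : CommRingCat.{u}} (φ : R ⟶ A) (ψ : R ⟶ B) {ι : Type u}
    (D : ι → CommRingCat.{u}) (a : ∀ i, A ⟶ D i) (b : ∀ i, B ⟶ D i)
    (h : ∀ i, φ ≫ a i = ψ ≫ b i) : (pushout φ ψ : CommRingCat.{u}) →+* (∀ i, D i) :=
  RingHom.pi fun i => (pushout.desc (a i) (b i) (h i)).hom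

namespace RingedPoset

/-- A finite ringed poset is a schematic space if its restriction maps are flat and, for all
`t ≤ x, y`, the map `O_x ⊗_{O_t} O_y → ∏_{z ≥ x, y} O_z` is faithfully flat. -/
structure IsSchematic (X : RingedPoset.{u}) : Prop where
  flat : ∀ {x y : X} (h : x ≤ y), (X.res h).hom.Flat
  faithfullyFlat : ∀ {t x y : X} (hx : t ≤ x) (hy : t ≤ y),
    (tensorToProd (X.res hx) (X.res hy) (fun z : {z : X // x ≤ z ∧ y ≤ z} => X.stalk z.1)
      (fun z => X.res z.2.1) (fun z => X.res z.2.2)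
      (fun z => by rw [CData.res_res, CData.res_res])).FaithfullyFlat

/-- A morphism `f : X ⟶ Y` is schematic if for all `x` and `y ≥ f(x)` the map
`O_{X,x} ⊗_{O_{Y,f(x)}} O_{Y,y} → ∏_{z ∈ U_x ∩ f⁻¹(U_y)} O_{X,z}` induces a surjection between
prime spectra. -/
def IsSchematicHom {X Y : RingedPoset.{u}} (f : X ⟶ Y) : Prop :=
  ∀ (x : X) (y : Y) (h : f.base x ≤ y), Function.Surjective
    (PrimeSpectrum.comap (tensorToProd (f.sharp x) (Y.res h)
      (fun z : {z : X // x ≤ z ∧ y ≤ f.base z} => X.stalk z.1)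
      (fun z => X.res z.2.1) (fun z => f.toLE z.2.2)
      (fun z => (f.naturality z.2.1).symm.trans (CData.res_toLE f h z.2.2).symm)))

/-- A ringed poset is pseudo-schematic if its restriction maps are flat epimorphisms of rings. -/
def IsPseudoSchematic (X : RingedPoset.{u}) : Prop :=
  ∀ {x y : X} (h : x ≤ y), (X.res h).hom.Flat ∧ Epi (X.res h)

/-! ### Modules, global sections and `Mod`-affinity -/

/-- The ring `O_X(X) = lim_x O_{X,x}` of global sections, as a subring of the product. -/
def sections (X : RingedPoset.{u}) : Subring (∀ x : X, X.stalk x) where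
  carrier := {s | ∀ (x y : X) (h : x ≤ y), (X.res h).hom (s x) = s y}
  mul_mem' hs ht x y h := by simp [hs x y h, ht x y h]
  one_mem' _ _ _ := by simp
  add_mem' hs ht x y h := by simp [hs x y h, ht x y h]
  zero_mem' _ _ _ := by simp
  neg_mem' hs x y h := by simp [hs x y h]

/-- Evaluation `O_X(X) → O_{X,x}` of global sections. -/
def eval (X : RingedPoset.{u}) (x : X) : X.sections →+* X.stalk x :=
  (Pi.evalRingHom (fun x : X => (X.stalk x : Type u)) x).comp X.sections.subtype

instance (X : RingedPoset.{u}) (x : X) : Algebra X.sections (X.stalk x) :=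
  (X.eval x).toAlgebra

/-- The restriction map `O_{X,x} → O_{X,y}` as an `O_X(X)`-linear map. -/
def resLinear (X : RingedPoset.{u}) {x y : X} (h : x ≤ y) :
    X.stalk x →ₗ[X.sections] X.stalk y where
  toFun := (X.res h).hom
  map_add' := map_add _
  map_smul' r a := by
    rw [Algebra.smul_def, Algebra.smul_def, map_mul]
    exact congrArg (· * _) (r.2 x y h)

end RingedPoset

/-- A semilinear map `f : M → N` along a ring homomorphism `φ : R → S` of commutative rings
exhibits `N` as the base change of `M`: the induced `S`-linear map `S ⊗_R M → N`,
`s ⊗ m ↦ s • f m`, is an isomorphism. -/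
def IsBaseChangeAlong {R S M N : Type u} [CommRing R] [CommRing S] [AddCommGroup M]
    [AddCommGroup N] [Module R M] [Module S N] {φ : R →+* S} (f : M →ₛₗ[φ] N) : Prop :=
  letI : Algebra R S := φ.toAlgebra
  letI : Module R N := Module.compHom N φ
  haveI : IsScalarTower R S N := ⟨fun r s n => mul_smul (φ r) s n⟩
  IsBaseChange S ({ toFun := f, map_add' := f.map_add, map_smul' := f.map_smulₛₗ } : M →ₗ[R] N)

/-- A sheaf of modules on a ringed poset: an `O_{X,x}`-module for each point `x`, with functorial
semilinear restriction maps. -/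
structure OModule (X : RingedPoset.{u}) where
  /-- the stalks -/
  obj : X → Type u
  [addCommGroup : ∀ x, AddCommGroup (obj x)]
  [module : ∀ x, Module (X.stalk x) (obj x)]
  /-- the restriction maps -/
  res : ∀ {x y : X} (h : x ≤ y), obj x →ₛₗ[(X.res h).hom] obj y
  res_refl : ∀ {x : X} (m : obj x), res (le_refl x) m = m
  res_res : ∀ {x y z : X} (h : x ≤ y) (h' : y ≤ z) (m : obj x),
    res h' (res h m) = res (h.trans h') m

namespace OModule

attribute [instance] addCommGroup module

variable {X : RingedPoset.{u}}

/-- `M` is quasi-coherent if `O_{X,y} ⊗_{O_{X,x}} M_x → M_y` is an isomorphism for `x ≤ y`. -/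
def IsQuasiCoherent (M : OModule X) : Prop :=
  ∀ {x y : X} (h : x ≤ y), IsBaseChangeAlong (M.res h)

/-- The `O_X(X)`-module `π_* M = lim_x M_x` of global sections. -/
def sections (M : OModule X) : Submodule X.sections (∀ x : X, M.obj x) where
  carrier := {s | ∀ (x y : X) (h : x ≤ y), M.res h (s x) = s y}
  add_mem' hs ht x y h := by simp [hs x y h, ht x y h]
  zero_mem' _ _ _ := by simp
  smul_mem' r s hs x y h := by
    have h1 := (M.res h).map_smulₛₗ (r.1 x) (s x)
    rw [hs x y h] at h1
    exact h1.trans (congrArg (· • s y) (r.2 x y h))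

/-- Evaluation `π_* M → M_x` of global sections, semilinear along `O_X(X) → O_{X,x}`. Its adjoint
`O_{X,x} ⊗_{O_X(X)} π_* M → M_x` is the counit `π^* π_* M → M` at `x`. -/
def eval (M : OModule X) (x : X) : M.sections →ₛₗ[X.eval x] M.obj x where
  toFun s := s.1 x
  map_add' _ _ := rfl
  map_smul' _ _ := rfl

open scoped TensorProduct in
/-- The sheaf of modules `π^* N`, with stalks `O_{X,x} ⊗_{O_X(X)} N`. -/
noncomputable def pullback (X : RingedPoset.{u}) (N : Type u) [AddCommGroup N]
    [Module X.sections N] : OModule X where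
  obj x := X.stalk x ⊗[X.sections] N
  res {x y} h :=
    { toFun := (X.resLinear h).rTensor N
      map_add' := map_add _
      map_smul' := fun r m => by
        induction m using TensorProduct.induction_on with
        | zero => simp
        | tmul a n =>
          simp only [TensorProduct.smul_tmul', LinearMap.rTensor_tmul, smul_eq_mul]
          exact congrArg (· ⊗ₜ[X.sections] n) (map_mul (X.res h).hom r a)
        | add a b ha hb => rw [smul_add, map_add, ha, hb, map_add, smul_add] }
  res_refl {x} m := by
    have : X.resLinear (le_refl x) = LinearMap.id :=
      LinearMap.ext fun a => by
        change (X.res (le_refl x)).hom a = a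
        rw [CData.res_refl]
        rfl
    change (X.resLinear (le_refl x)).rTensor N m = m
    rw [this, LinearMap.rTensor_id]
    rfl
  res_res {x y z} h h' m := by
    have : X.resLinear (h.trans h') = X.resLinear h' ∘ₗ X.resLinear h :=
      LinearMap.ext fun a => by
        change (X.res (h.trans h')).hom a = (X.res h').hom ((X.res h).hom a)
        rw [← CData.res_res X h h']
        rfl
    change (X.resLinear h').rTensor N ((X.resLinear h).rTensor N m) =
      (X.resLinear (h.trans h')).rTensor N m
    rw [this, LinearMap.rTensor_comp]
    rfl

open scoped TensorProduct in
/-- The unit `N → π_* π^* N`, `n ↦ (1 ⊗ n)_x`. -/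
noncomputable def unit (X : RingedPoset.{u}) (N : Type u) [AddCommGroup N]
    [Module X.sections N] (n : N) : (pullback X N).sections :=
  ⟨fun x => (1 : X.stalk x) ⊗ₜ[X.sections] n, fun _ _ h =>
    congrArg (· ⊗ₜ[X.sections] n) (map_one (X.res h).hom)⟩

end OModule

namespace RingedPoset

/-- `X` is `Mod`-affine if the projection `π : X → (⋆, O_X(X))` induces an adjoint equivalence
`π^* ⊣ π_*` between `O_X(X)`-modules and quasi-coherent sheaves of modules on `X`, i.e. the unit
`N → π_* π^* N` is an isomorphism for every `O_X(X)`-module `N`, and the counit `π^* π_* M → M` is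
an isomorphism for every quasi-coherent `M`. -/
structure IsModAffine (X : RingedPoset.{u}) : Prop where
  unit : ∀ (N : Type u) [AddCommGroup N] [Module X.sections N],
    Function.Bijective (OModule.unit X N)
  counit : ∀ (M : OModule X), M.IsQuasiCoherent → ∀ x : X, IsBaseChangeAlong (M.eval x)

/-- The stalk at `y` of `f_♯ : O_Y → f_* O_X`, that is `O_{Y,y} → O_X(f⁻¹(U_y))`. -/
def toPushforward {X Y : RingedPoset.{u}} (f : X ⟶ Y) (y : Y) :
    Y.stalk y →+* (sections (X.restrict {x | y ≤ f.base x})) :=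
  (RingHom.pi fun x : {x : X // y ≤ f.base x} => (f.toLE x.2).hom).codRestrict
    (sections (X.restrict {x | y ≤ f.base x})) (fun r x x' h =>
      congrArg (fun φ : Y.stalk y ⟶ X.stalk x'.1 => φ.hom r) (CData.toLE_res f x.2 h))

/-- A morphism `f : X ⟶ Y` between pseudo-schematic ringed posets is a qc-isomorphism if
`f⁻¹(U_y)` is `Mod`-affine for all `y ∈ Y` and `f_♯ : O_Y → f_* O_X` is an isomorphism. -/
structure IsQcIso {X Y : RingedPoset.{u}} (f : X ⟶ Y) : Prop where
  source : X.IsPseudoSchematic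
  target : Y.IsPseudoSchematic
  modAffine : ∀ y : Y, IsModAffine (X.restrict {x | y ≤ f.base x})
  bijective : ∀ y : Y, Function.Bijective (toPushforward f y)

end RingedPoset

/-! ## Data of schematic spaces -/

/-- Data with values in the opposite of the category of ringed posets: functors
`p ↦ 𝒳(p)` from a finite poset to `RingedPosetᵒᵖ`. -/
abbrev RingedPosetData : Type (u + 1) := CData.{u} (RingedPoset.{u})ᵒᵖ

namespace RingedPosetData

/-- `𝒳` takes values in the (non-full) subcategory of schematic spaces and schematic morphisms. -/
structure IsSchFin (X : RingedPosetData.{u}) : Prop where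
  obj : ∀ p : X, RingedPoset.IsSchematic (X.stalk p).unop
  trans : ∀ {p q : X} (h : p ≤ q), RingedPoset.IsSchematicHom (CData.trans X h)

/-- `f : 𝒳 ⟶ 𝒴` is a morphism of data of schematic spaces: its components
`𝒳(p) ⟶ 𝒴(f(p))` are schematic. -/
def IsSchFinHom {X Y : RingedPosetData.{u}} (f : X ⟶ Y) : Prop :=
  ∀ p : X, RingedPoset.IsSchematicHom (CData.component f p)

end RingedPosetData

/-! A point `w = (x, y)` of the fibred product satisfies `f_p(x) = 𝒴_{pq}(y)`. Its preimage
`ρ⁻¹(U_w)` is `U_{x_p} ∩ Cyl(f)⁻¹(U_{y_q})`, and its stalk `O_w` is the tensor product occurring in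
the schematicity condition of `Cyl(f)` at `(x_p, y_q)`.

If `Cyl(f)` is schematic, then `O_w → ∏ O_z` over `z ∈ ρ⁻¹(U_w)` is surjective on spectra. It is
also flat, because `Cyl(𝒳)` has flat restrictions and `O_{x_p} → O_w` is an epimorphism. So it is
faithfully flat. The overlap maps `O_z ⊗_{O_w} O_{z'} → ∏ O_v` over `v ≥ z, z'` are faithfully flat
because `Cyl(𝒳)` is schematic. Faithfully flat descent on a finite poset then shows that `O_w` is
the ring of sections and that the preimage is `Mod`-affine (`bijective_of_faithfullyFlatOverlaps`,
`isModAffine_of_faithfullyFlatOverlaps`). The core of the descent is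
`IsSeparatedOver.exists_eq_of_mem_sectionsOver` for units and
`IsQuasiCoherent.isBaseChange_evalOver` for counits.

For the converse, surjectivity on spectra means that field-valued points lift after a field
extension. A qc-isomorphism has this lifting property at every `w`: the unit is injective on the
nonzero module `k`, so some stalk of the fibre has a nonzero tensor product with `k`
(`exists_field_of_isQcIso`). The condition for `Cyl(f)` also concerns pairs with only `f_p(x) ≤
𝒴_{pq}(y)`. Schematicity of `f_p` and of `𝒴_{pq}` moves such a pair strictly upwards together with
its field point, and by finiteness equality is reached (`exists_field_cyl`). -/

open scoped TensorProduct

/-! ### Modules over a ring with a finite faithfully flat family of algebras -/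

section FlatFamilies

variable {R : Type*} [CommRing R]

theorem TensorProduct.piRight_eq_lTensor_proj {ι : Type*} [Fintype ι] [DecidableEq ι] (B : Type*)
    [AddCommGroup B] [Module R B] (M : ι → Type*) [∀ i, AddCommGroup (M i)] [∀ i, Module R (M i)]
    (t : B ⊗[R] (∀ i, M i)) (i : ι) :
    TensorProduct.piRight R R B M t i =
      (LinearMap.proj i : (∀ i, M i) →ₗ[R] M i).lTensor B t := by
  induction t using TensorProduct.induction_on with
  | zero => simp
  | tmul b m => simp
  | add a b ha hb => rw [map_add, map_add, Pi.add_apply, ha, hb]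

theorem TensorProduct.eq_zero_of_lTensor_proj {ι : Type*} [Finite ι] (B : Type*) [AddCommGroup B]
    [Module R B] (M : ι → Type*) [∀ i, AddCommGroup (M i)] [∀ i, Module R (M i)]
    (t : B ⊗[R] (∀ i, M i)) (h : ∀ i, (LinearMap.proj i : (∀ i, M i) →ₗ[R] M i).lTensor B t = 0) :
    t = 0 := by
  classical
  cases nonempty_fintype ι
  refine (TensorProduct.piRight R R B M).injective ?_
  rw [map_zero]
  exact funext fun i => (TensorProduct.piRight_eq_lTensor_proj B M t i).trans (h i)

theorem TensorProduct.exists_lTensor_proj {ι : Type*} [Finite ι] (B : Type*) [AddCommGroup B]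
    [Module R B] (M : ι → Type*) [∀ i, AddCommGroup (M i)] [∀ i, Module R (M i)]
    (t : ∀ i, B ⊗[R] M i) :
    ∃ s : B ⊗[R] (∀ i, M i),
      ∀ i, (LinearMap.proj i : (∀ i, M i) →ₗ[R] M i).lTensor B s = t i := by
  classical
  cases nonempty_fintype ι
  obtain ⟨s, rfl⟩ := (TensorProduct.piRight R R B M).surjective t
  exact ⟨s, fun i => (TensorProduct.piRight_eq_lTensor_proj B M s i).symm⟩

/-- Flat base change preserves the common kernel of finitely many maps. When the `d k` are the
equations defining a section, this compares `B ⊗ lim M` with compatible families in the `B ⊗ M_z`.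
-/
theorem Module.Flat.exists_lTensor_subtype {κ : Type*} [Finite κ] (B : Type*) [AddCommGroup B]
    [Module R B] [Module.Flat R B] {M : Type*} [AddCommGroup M] [Module R M]
    (P : κ → Type*) [∀ k, AddCommGroup (P k)] [∀ k, Module R (P k)] (d : ∀ k, M →ₗ[R] P k)
    (L : Submodule R M) (hL : ∀ m, (∀ k, d k m = 0) → m ∈ L)
    (t : B ⊗[R] M) (ht : ∀ k, (d k).lTensor B t = 0) :
    ∃ s : B ⊗[R] L, L.subtype.lTensor B s = t := by
  have h0 : (LinearMap.pi d).lTensor B t = 0 := by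
    refine TensorProduct.eq_zero_of_lTensor_proj B P _ fun k => ?_
    rw [← LinearMap.comp_apply, ← LinearMap.lTensor_comp, LinearMap.proj_pi]
    exact ht k
  have hex := Module.Flat.lTensor_exact B (LinearMap.exact_subtype_ker_map (LinearMap.pi d))
  obtain ⟨s, rfl⟩ := (hex t).1 h0
  have hle : LinearMap.ker (LinearMap.pi d) ≤ L := fun m hm =>
    hL m fun k => congrFun (LinearMap.mem_ker.1 hm) k
  refine ⟨(Submodule.inclusion hle).lTensor B s, ?_⟩
  rw [← LinearMap.comp_apply, ← LinearMap.lTensor_comp]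
  rfl

variable {ι : Type*} [Finite ι] (O : ι → Type*) [∀ i, CommRing (O i)] [∀ i, Algebra R (O i)]
  [Module.FaithfullyFlat R (∀ i, O i)]

/-- If `R → ∏ i, O i` is faithfully flat and `N → M i` is a base change along `R → O i`, then
`N → ∏ i, M i` is injective. -/
theorem Module.FaithfullyFlat.eq_zero_of_isBaseChange {N : Type*} [AddCommGroup N] [Module R N]
    {M : ι → Type*} [∀ i, AddCommGroup (M i)] [∀ i, Module (O i) (M i)] [∀ i, Module R (M i)]
    [∀ i, IsScalarTower R (O i) (M i)] (f : ∀ i, N →ₗ[R] M i)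
    (hf : ∀ i, IsBaseChange (O i) (f i)) (n : N) (h : ∀ i, f i n = 0) : n = 0 := by
  -- Faithful flatness reduces the claim to `1 ⊗ n = 0` in `(∏ O i) ⊗ N`; as `ι` is finite, this can
  -- be checked one factor at a time.
  refine (Module.FaithfullyFlat.one_tmul_eq_zero_iff R N (A := ∀ i, O i) n).1 ?_
  refine (TensorProduct.comm R _ _).injective ?_
  rw [map_zero]
  refine TensorProduct.eq_zero_of_lTensor_proj N O _ fun i => ?_
  refine (TensorProduct.comm R _ _).injective ((hf i).equiv.injective ?_)
  simp [h]

/-- Surjectivity may be checked after base change along a faithfully flat family. -/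
theorem Module.FaithfullyFlat.surjective_of_lTensor {N L : Type*} [AddCommGroup N] [Module R N]
    [AddCommGroup L] [Module R L] (g : N →ₗ[R] L)
    (h : ∀ i, Function.Surjective (g.lTensor (O i))) : Function.Surjective g := by
  -- The cokernel of `g` vanishes if each of its elements dies in every `O i ⊗ coker g`.
  rw [← LinearMap.range_eq_top, ← Submodule.Quotient.subsingleton_iff]
  refine subsingleton_of_forall_eq 0 fun q => ?_
  refine Module.FaithfullyFlat.eq_zero_of_isBaseChange O
    (fun i => TensorProduct.mk R (O i) (L ⧸ LinearMap.range g) 1)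
    (fun i => TensorProduct.isBaseChange R _ (O i)) q fun i => ?_
  obtain ⟨l, rfl⟩ := Submodule.mkQ_surjective _ q
  obtain ⟨t, ht⟩ := h i (1 ⊗ₜ l)
  have h1 := congrArg ((LinearMap.range g).mkQ.lTensor (O i)) ht
  rw [← LinearMap.comp_apply, ← LinearMap.lTensor_comp, LinearMap.range_mkQ_comp,
    LinearMap.lTensor_zero] at h1
  simpa using h1.symm

omit [Finite ι] in
theorem Module.FaithfullyFlat.flat_of_pi (i : ι) : Module.Flat R (O i) := by
  classical
  exact Module.Flat.of_retract (LinearMap.single R O i) (LinearMap.proj i)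
    (LinearMap.ext fun x => by simp)

end FlatFamilies

/-- `IsBaseChangeAlong` builds its own algebra and module instances; this lemma replaces them by any
compatible ambient ones, so that the `IsBaseChange` API applies. -/
theorem isBaseChangeAlong_iff {R S M N : Type u} [CommRing R] [CommRing S] [AddCommGroup M]
    [AddCommGroup N] [Module R M] [Module S N] {φ : R →+* S} (f : M →ₛₗ[φ] N)
    [Algebra R S] [Module R N] [IsScalarTower R S N] (hφ : ∀ r, φ r = algebraMap R S r)
    (f' : M →ₗ[R] N) (h : ∀ m, f' m = f m) : IsBaseChangeAlong f ↔ IsBaseChange S f' := by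
  rename_i i1 i2 i3
  have e1 : i1 = φ.toAlgebra := Algebra.algebra_ext _ _ fun r => (hφ r).symm
  subst e1
  let := φ.toAlgebra
  have e2 : i2 = Module.compHom N φ :=
    Module.ext' _ _ fun r n => (algebraMap_smul S r n).symm
  subst e2
  let := Module.compHom N φ
  unfold IsBaseChangeAlong
  rw [show f' = { toFun := f, map_add' := f.map_add, map_smul' := f.map_smulₛₗ } from
    LinearMap.ext h]

/-! ### Sections of a system of modules over a base ring, and descent -/

/-- The `A`-algebra structures on the stalks of `Z` are compatible with restriction. -/
class RingedPoset.IsOver (A : Type u) [CommRing A] (Z : RingedPoset.{u})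
    [∀ z : Z, Algebra A (Z.stalk z)] : Prop where
  res_algebraMap : ∀ {x y : Z} (h : x ≤ y) (a : A),
    (Z.res h).hom (algebraMap A (Z.stalk x) a) = algebraMap A (Z.stalk y) a

/-- The restriction of a sheaf of modules to a subset. -/
def OModule.restrict {Z : RingedPoset.{u}} (M : OModule Z) (U : Set Z) :
    OModule (CData.restrict Z U) where
  obj w := M.obj w.1
  addCommGroup w := M.addCommGroup w.1
  module w := M.module w.1
  res h := M.res (x := _) (y := _) h
  res_refl m := M.res_refl m
  res_res h h' m := M.res_res h h' m

namespace RingedPoset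

variable (A : Type u) [CommRing A] {Z : RingedPoset.{u}}
  [∀ z : Z, Algebra A (Z.stalk z)] [IsOver A Z]

/-- Restriction maps as homomorphisms of `A`-algebras. -/
def resAlgHom {x y : Z} (h : x ≤ y) : Z.stalk x →ₐ[A] Z.stalk y :=
  { (Z.res h).hom with commutes' := IsOver.res_algebraMap h }

/-- The homomorphism `O_z ⊗_A O_x → O_w` for `z, x ≤ w`. -/
noncomputable def tensorStalkMap {z x w : Z} (hz : z ≤ w) (hx : x ≤ w) :
    Z.stalk z ⊗[A] Z.stalk x →ₐ[A] Z.stalk w :=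
  Algebra.TensorProduct.productMap (resAlgHom A hz) (resAlgHom A hx)

end RingedPoset

namespace OModule

open RingedPoset

section System

variable (A : Type u) [CommRing A] {Z : RingedPoset.{u}}
  [∀ z : Z, Algebra A (Z.stalk z)] [IsOver A Z] (M : OModule Z)
  [∀ z, Module A (M.obj z)] [∀ z, IsScalarTower A (Z.stalk z) (M.obj z)]

/-- Restriction maps as `A`-linear maps. -/
def resLinear {x y : Z} (h : x ≤ y) : M.obj x →ₗ[A] M.obj y where
  toFun := M.res h
  map_add' := map_add _
  map_smul' a m := by
    rw [← algebraMap_smul (Z.stalk x), map_smulₛₗ, IsOver.res_algebraMap, algebraMap_smul]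
    rfl

/-- The `A`-module `lim_z M_z`. -/
def sectionsOver : Submodule A (∀ z, M.obj z) where
  carrier := {s | ∀ (x y : Z) (h : x ≤ y), M.res h (s x) = s y}
  add_mem' hs ht x y h := by simp [hs x y h, ht x y h]
  zero_mem' _ _ _ := by simp
  smul_mem' a s hs x y h := ((resLinear A M h).map_smul a (s x)).trans
    (congrArg (a • ·) (hs x y h))

/-- Evaluation of global sections at a point. -/
def evalOver (z : Z) : M.sectionsOver A →ₗ[A] M.obj z :=
  LinearMap.proj z ∘ₗ (M.sectionsOver A).subtype

/-- The map `O_x ⊗_A M_z → M_w`, `a ⊗ m ↦ a|_w • m|_w`, for `x, z ≤ w`. -/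
noncomputable def smulMap {x z w : Z} (hx : x ≤ w) (hz : z ≤ w) :
    Z.stalk x ⊗[A] M.obj z →ₗ[A] M.obj w :=
  TensorProduct.lift ((((LinearMap.lsmul (Z.stalk w) (M.obj w)).restrictScalars₁₂ A A).compl₂
    (resLinear A M hz)).comp (resAlgHom A hx).toLinearMap)

@[simp]
theorem smulMap_tmul {x z w : Z} (hx : x ≤ w) (hz : z ≤ w) (a : Z.stalk x) (m : M.obj z) :
    smulMap A M hx hz (a ⊗ₜ m) = (Z.res hx).hom a • M.res hz m := rfl

theorem smulMap_tmul_self {x : Z} (a : Z.stalk x) (m : M.obj x) :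
    smulMap A M (le_refl x) (le_refl x) (a ⊗ₜ m) = a • m :=
  congrArg₂ (· • ·) (congrArg (fun φ : Z.stalk x ⟶ Z.stalk x => φ.hom a)
    (CData.res_refl Z (le_refl x))) (M.res_refl m)

theorem smulMap_lTensor_res {x z z' w : Z} (hx : x ≤ w) (hz : z ≤ z') (hz' : z' ≤ w)
    (t : Z.stalk x ⊗[A] M.obj z) :
    smulMap A M hx hz' ((resLinear A M hz).lTensor _ t) = smulMap A M hx (hz.trans hz') t := by
  induction t using TensorProduct.induction_on with
  | zero => simp
  | tmul a m =>
    exact congrArg ((Z.res hx).hom a • ·) (M.res_res hz hz' m)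
  | add a b ha hb => simp only [map_add, ha, hb]

theorem res_smulMap {x z w w' : Z} (hx : x ≤ w) (hz : z ≤ w) (h : w ≤ w')
    (t : Z.stalk x ⊗[A] M.obj z) :
    M.res h (smulMap A M hx hz t) = smulMap A M (hx.trans h) (hz.trans h) t := by
  induction t using TensorProduct.induction_on with
  | zero => simp
  | tmul a m =>
    rw [smulMap_tmul, smulMap_tmul, map_smulₛₗ, M.res_res, ← CData.res_res Z hx h]
    rfl
  | add a b ha hb => simp only [map_add, ha, hb]

/-- The maps `O_x ⊗_A M_z → ∏_{w ≥ x, z} M_w` are injective. -/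
def IsSeparatedOver : Prop :=
  ∀ (x z : Z) (t : Z.stalk x ⊗[A] M.obj z),
    (∀ (w : Z) (hx : x ≤ w) (hz : z ≤ w), smulMap A M hx hz t = 0) → t = 0

theorem lTensor_res_lTensor_eval {x z z' : Z} (h : z ≤ z')
    (t : Z.stalk x ⊗[A] M.sectionsOver A) :
    (resLinear A M h).lTensor (Z.stalk x) ((evalOver A M z).lTensor _ t) =
      (evalOver A M z').lTensor _ t := by
  rw [← LinearMap.comp_apply, ← LinearMap.lTensor_comp]
  congr 2
  exact LinearMap.ext fun s => s.2 z z' h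

variable {A M}

/-- If `M` is separated over `A`, the counit `O_x ⊗_A lim M → M_x` is injective. -/
theorem IsSeparatedOver.counit_injective (hM : M.IsSeparatedOver A) (x : Z)
    [Module.Flat A (Z.stalk x)] (t : Z.stalk x ⊗[A] M.sectionsOver A)
    (h : smulMap A M le_rfl le_rfl ((evalOver A M x).lTensor _ t) = 0) : t = 0 := by
  -- Flatness embeds `O_x ⊗ lim M` into `∏ O_x ⊗ M_z`. Separatedness tests the `z`-component in the
  -- `M_w` with `w ≥ x, z`, where it is the restriction of the counit's value at `x`, which is zero.
  refine Module.Flat.lTensor_preserves_injective_linearMap (M := Z.stalk x)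
    (M.sectionsOver A).subtype (Submodule.subtype_injective _) ?_
  rw [map_zero]
  refine TensorProduct.eq_zero_of_lTensor_proj _ _ _ fun z => ?_
  rw [← LinearMap.comp_apply, ← LinearMap.lTensor_comp]
  refine hM x z _ fun w hx hz => ?_
  have h1 : smulMap A M hx hz ((evalOver A M z).lTensor (Z.stalk x) t) =
      smulMap A M hx le_rfl ((evalOver A M w).lTensor (Z.stalk x) t) := by
    rw [← lTensor_res_lTensor_eval A M hz, smulMap_lTensor_res]
  have h2 : smulMap A M hx le_rfl ((evalOver A M w).lTensor (Z.stalk x) t) =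
      M.res hx (smulMap A M le_rfl le_rfl ((evalOver A M x).lTensor _ t)) := by
    rw [← lTensor_res_lTensor_eval A M hx, smulMap_lTensor_res, res_smulMap]
  exact h1.trans (h2.trans (by rw [h, map_zero]))

/-- Descent: a module whose base changes are the stalks of a separated system `M` along a
faithfully flat family surjects onto the sections of `M`. -/
theorem IsSeparatedOver.exists_eq_of_mem_sectionsOver (hM : M.IsSeparatedOver A)
    [Module.FaithfullyFlat A (∀ z : Z, Z.stalk z)] {N : Type*} [AddCommGroup N] [Module A N]
    (f : ∀ z, N →ₗ[A] M.obj z) (hf : ∀ z, IsBaseChange (Z.stalk z) (f z))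
    (hres : ∀ (x y : Z) (h : x ≤ y) (n : N), M.res h (f x n) = f y n)
    (s : ∀ z, M.obj z) (hs : s ∈ M.sectionsOver A) : ∃ n, ∀ z, f z n = s z := by
  let g : N →ₗ[A] M.sectionsOver A :=
    LinearMap.codRestrict _ (LinearMap.pi f) fun n x y h => hres x y h n
  have hg : Function.Surjective g := by
    refine Module.FaithfullyFlat.surjective_of_lTensor (fun z : Z => (Z.stalk z : Type u)) g
      fun x t => ?_
    have := Module.FaithfullyFlat.flat_of_pi (R := A) (fun z : Z => (Z.stalk z : Type u)) x
    -- After tensoring with `O_x`, the module `N` becomes `M_x`, so `g` followed by the counit is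
    -- bijective; injectivity of the counit then makes `g` surjective.
    obtain ⟨n, hn⟩ := (hf x).equiv.surjective
      (smulMap A M le_rfl le_rfl ((evalOver A M x).lTensor _ t))
    refine ⟨n, sub_eq_zero.1 (hM.counit_injective x _ ?_)⟩
    rw [map_sub, map_sub, sub_eq_zero, ← hn]
    clear hn
    induction n using TensorProduct.induction_on with
    | zero => simp
    | tmul a n =>
      rw [IsBaseChange.equiv_tmul, LinearMap.lTensor_tmul, LinearMap.lTensor_tmul, smulMap_tmul_self]
      rfl
    | add a b ha hb => simp only [map_add, ha, hb]
  obtain ⟨n, hn⟩ := hg ⟨s, hs⟩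
  exact ⟨n, fun z => congrFun (congrArg Subtype.val hn) z⟩

end System

end OModule

/-! ### Quasi-coherent modules over a base with faithfully flat overlaps -/

namespace RingedPoset

/-- For all `z, x`, the map `O_z ⊗_A O_x → ∏_{w ≥ z, x} O_w` is faithfully flat. -/
def HasFaithfullyFlatOverlaps (A : Type u) [CommRing A] (Z : RingedPoset.{u})
    [∀ z : Z, Algebra A (Z.stalk z)] [IsOver A Z] : Prop :=
  ∀ z x : Z, (RingHom.pi fun w : {w : Z // z ≤ w ∧ x ≤ w} =>
    (tensorStalkMap A w.2.1 w.2.2).toRingHom).FaithfullyFlat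

end RingedPoset

namespace OModule

open RingedPoset

section Tensor

variable (A : Type u) [CommRing A] {Z : RingedPoset.{u}}
  [∀ z : Z, Algebra A (Z.stalk z)] [IsOver A Z] (M : OModule Z)
  [∀ z, Module A (M.obj z)] [∀ z, IsScalarTower A (Z.stalk z) (M.obj z)] (z x : Z)

/-- The poset of common upper bounds of `z` and `x`. -/
abbrev overlap : RingedPoset.{u} := CData.restrict Z {w | z ≤ w ∧ x ≤ w}

/-- The algebra structure on `O_w` over `O_z ⊗_A O_x`, for `z, x ≤ w`. -/
noncomputable abbrev overlapAlgebra (w : overlap z x) :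
    Algebra (Z.stalk z ⊗[A] Z.stalk x) ((overlap z x).stalk w) :=
  (tensorStalkMap A w.2.1 w.2.2).toRingHom.toAlgebra

/-- The module structure on `M_w` over `O_z ⊗_A O_x`, for `z, x ≤ w`. -/
noncomputable abbrev overlapModule (w : overlap z x) :
    Module (Z.stalk z ⊗[A] Z.stalk x) ((M.restrict {w | z ≤ w ∧ x ≤ w}).obj w) :=
  Module.compHom (M.obj w.1) (tensorStalkMap A w.2.1 w.2.2).toRingHom

attribute [local instance] overlapAlgebra overlapModule

instance (w : overlap z x) : IsScalarTower (Z.stalk z ⊗[A] Z.stalk x) ((overlap z x).stalk w)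
    ((M.restrict {w | z ≤ w ∧ x ≤ w}).obj w) :=
  ⟨fun t s m => mul_smul (tensorStalkMap A w.2.1 w.2.2 t) s (show M.obj w.1 from m)⟩

instance : IsOver (Z.stalk z ⊗[A] Z.stalk x) (overlap z x) := ⟨fun {v w} h t => by
  change (Z.res h).hom (tensorStalkMap A v.2.1 v.2.2 t) = tensorStalkMap A w.2.1 w.2.2 t
  induction t using TensorProduct.induction_on with
  | zero => simp
  | tmul a b =>
    simp only [tensorStalkMap, Algebra.TensorProduct.productMap_apply_tmul, map_mul]
    exact congrArg₂ (· * ·)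
      (congrArg (fun φ : Z.stalk z ⟶ Z.stalk w.1 => φ.hom a) (CData.res_res Z v.2.1 h))
      (congrArg (fun φ : Z.stalk x ⟶ Z.stalk w.1 => φ.hom b) (CData.res_res Z v.2.2 h))
  | add a b ha hb => simp only [map_add, ha, hb]⟩

variable {A}

theorem _root_.RingedPoset.HasFaithfullyFlatOverlaps.overlap (hZ : HasFaithfullyFlatOverlaps A Z) :
    Module.FaithfullyFlat (Z.stalk z ⊗[A] Z.stalk x)
      (∀ w : overlap z x, (overlap z x).stalk w) := by
  rw [← RingHom.faithfullyFlat_algebraMap_iff]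
  exact hZ z x

variable {M}

/-- Separatedness passes to the overlaps. -/
theorem IsSeparatedOver.overlap (hM : M.IsSeparatedOver A) :
    (M.restrict {w | z ≤ w ∧ x ≤ w}).IsSeparatedOver (Z.stalk z ⊗[A] Z.stalk x) := by
  let T := Z.stalk z ⊗[A] Z.stalk x
  let (u : OModule.overlap z x) : Algebra A ((OModule.overlap z x).stalk u) :=
    inferInstanceAs (Algebra A (Z.stalk u.1))
  let (u : OModule.overlap z x) : Module A ((M.restrict {w | z ≤ w ∧ x ≤ w}).obj u) :=
    inferInstanceAs (Module A (M.obj u.1))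
  have hT (u : OModule.overlap z x) : IsScalarTower A T ((OModule.overlap z x).stalk u) :=
    IsScalarTower.of_algebraMap_eq fun r =>
      ((tensorStalkMap A u.2.1 u.2.2).commutes r).symm
  have hT' (u : OModule.overlap z x) :
      IsScalarTower A T ((M.restrict {w | z ≤ w ∧ x ≤ w}).obj u) :=
    IsScalarTower.of_algebraMap_smul fun r m =>
      (congrArg (· • (show M.obj u.1 from m))
        ((tensorStalkMap A u.2.1 u.2.2).commutes r)).trans (algebraMap_smul (Z.stalk u.1) r _)
  intro v w t ht
  -- The tensor product over `T` is a quotient of the one over `A`; separatedness over `A` shows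
  -- that a lift of `t` already vanishes. Upper bounds of `v` and `w` in `Z` lie in the overlap
  -- automatically.
  let Φ := TensorProduct.mapOfCompatibleSMul T A A ((OModule.overlap z x).stalk v)
    ((M.restrict {w | z ≤ w ∧ x ≤ w}).obj w)
  obtain ⟨t, rfl⟩ := TensorProduct.mapOfCompatibleSMul_surjective T A A
    ((OModule.overlap z x).stalk v) ((M.restrict {w | z ≤ w ∧ x ≤ w}).obj w) t
  refine (congrArg Φ (hM v.1 w.1 t fun u hv hw => ?_)).trans (map_zero Φ)
  obtain ⟨u, rfl⟩ : ∃ u' : OModule.overlap z x, u'.1 = u :=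
    ⟨⟨u, v.2.1.trans hv, v.2.2.trans hv⟩, rfl⟩
  let Ψ := smulMap T (M.restrict {w | z ≤ w ∧ x ≤ w}) (x := v) (z := w) (w := u) hv hw
  refine Eq.trans ?_ (ht u hv hw)
  clear ht
  induction t using TensorProduct.induction_on with
  | zero =>
    exact (map_zero (smulMap A M hv hw)).trans ((congrArg Ψ (map_zero Φ)).trans (map_zero Ψ)).symm
  | tmul a m => rfl
  | add a b ha hb =>
    exact (map_add (smulMap A M hv hw) a b).trans ((congrArg₂ (· + ·) ha hb).trans
      ((congrArg Ψ (map_add Φ a b)).trans (map_add Ψ _ _)).symm)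

/-- The map `O_x ⊗_A M_z → (O_z ⊗_A O_x) ⊗_{O_z} M_z`. -/
noncomputable def toOverlapTensor :
    Z.stalk x ⊗[A] M.obj z ≃+ (Z.stalk z ⊗[A] Z.stalk x) ⊗[Z.stalk z] M.obj z :=
  ((TensorProduct.comm A _ _).toAddEquiv.trans
    (TensorProduct.AlgebraTensorModule.cancelBaseChange A (Z.stalk z) (Z.stalk z) (M.obj z)
      (Z.stalk x)).symm.toAddEquiv).trans (TensorProduct.comm (Z.stalk z) _ _).toAddEquiv

omit [IsOver A Z] in
theorem toOverlapTensor_tmul (a : Z.stalk x) (m : M.obj z) :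
    toOverlapTensor z x (a ⊗ₜ[A] m) = (1 ⊗ₜ[A] a) ⊗ₜ[Z.stalk z] m := rfl

omit [∀ z, Module A (M.obj z)] [∀ z, IsScalarTower A (Z.stalk z) (M.obj z)] in
/-- For quasi-coherent `M`, the map `(O_z ⊗_A O_x) ⊗_{O_z} M_z → M_w` is a base change. -/
theorem exists_isBaseChange_overlap (hM : M.IsQuasiCoherent) (w : OModule.overlap z x) :
    ∃ f : (Z.stalk z ⊗[A] Z.stalk x) ⊗[Z.stalk z] M.obj z →ₗ[Z.stalk z ⊗[A] Z.stalk x]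
        (M.restrict {w | z ≤ w ∧ x ≤ w}).obj w,
      IsBaseChange ((OModule.overlap z x).stalk w) f ∧
      ∀ t m, f (t ⊗ₜ m) = (show M.obj w.1 from
        tensorStalkMap A w.2.1 w.2.2 t • M.res w.2.1 m) := by
  let : Algebra (Z.stalk z) ((OModule.overlap z x).stalk w) := (Z.res w.2.1).hom.toAlgebra
  let : Module (Z.stalk z) ((M.restrict {w | z ≤ w ∧ x ≤ w}).obj w) :=
    Module.compHom (M.obj w.1) (Z.res w.2.1).hom
  have key (r : Z.stalk z) : tensorStalkMap A w.2.1 w.2.2 (r ⊗ₜ[A] 1) = (Z.res w.2.1).hom r := by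
    rw [tensorStalkMap, Algebra.TensorProduct.productMap_apply_tmul, map_one, mul_one]
    rfl
  have : IsScalarTower (Z.stalk z) ((OModule.overlap z x).stalk w)
      ((M.restrict {w | z ≤ w ∧ x ≤ w}).obj w) :=
    ⟨fun r s m => mul_smul ((Z.res w.2.1).hom r) s (show M.obj w.1 from m)⟩
  have : IsScalarTower (Z.stalk z) (Z.stalk z ⊗[A] Z.stalk x)
      ((OModule.overlap z x).stalk w) := IsScalarTower.of_algebraMap_eq fun r => (key r).symm
  have : IsScalarTower (Z.stalk z) (Z.stalk z ⊗[A] Z.stalk x)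
      ((M.restrict {w | z ≤ w ∧ x ≤ w}).obj w) := IsScalarTower.of_algebraMap_smul fun r m =>
    congrArg (· • (show M.obj w.1 from m)) (key r)
  let g : M.obj z →ₗ[Z.stalk z] (M.restrict {w | z ≤ w ∧ x ≤ w}).obj w :=
    { toFun := M.res w.2.1, map_add' := map_add _, map_smul' := (M.res w.2.1).map_smulₛₗ }
  have hg : IsBaseChange ((OModule.overlap z x).stalk w) g :=
    let : Algebra (Z.stalk z) (Z.stalk w.1) := (Z.res w.2.1).hom.toAlgebra
    let : Module (Z.stalk z) (M.obj w.1) := Module.compHom (M.obj w.1) (Z.res w.2.1).hom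
    have : IsScalarTower (Z.stalk z) (Z.stalk w.1) (M.obj w.1) :=
      ⟨fun r s m => mul_smul ((Z.res w.2.1).hom r) s m⟩
    (isBaseChangeAlong_iff (M.res w.2.1) (fun _ => rfl) g fun _ => rfl).1 (hM w.2.1)
  have hT := TensorProduct.isBaseChange (Z.stalk z) (M.obj z) (Z.stalk z ⊗[A] Z.stalk x)
  -- The base change `M_z → M_w` factors through `M_z → (O_z ⊗_A O_x) ⊗_{O_z} M_z`, itself a base
  -- change, so the second factor is one too.
  refine ⟨hT.lift g, IsBaseChange.of_comp hT ?_, fun t m => ?_⟩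
  · rw [hT.lift_comp]
    exact hg
  · have h1 : t ⊗ₜ[Z.stalk z] m = t • TensorProduct.mk (Z.stalk z) _ (M.obj z) 1 m := by
      simp [TensorProduct.smul_tmul']
    rw [h1, map_smul, hT.lift_eq]
    rfl

theorem eq_smulMap_of_overlap (w : OModule.overlap z x)
    (f : (Z.stalk z ⊗[A] Z.stalk x) ⊗[Z.stalk z] M.obj z →ₗ[Z.stalk z ⊗[A] Z.stalk x]
        (M.restrict {w | z ≤ w ∧ x ≤ w}).obj w)
    (hf : ∀ t m, f (t ⊗ₜ m) = (show M.obj w.1 from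
        tensorStalkMap A w.2.1 w.2.2 t • M.res w.2.1 m)) (t : Z.stalk x ⊗[A] M.obj z) :
    f (toOverlapTensor z x t) = smulMap A M w.2.2 w.2.1 t := by
  induction t using TensorProduct.induction_on with
  | zero =>
    rw [map_zero, map_zero, map_zero]
    rfl
  | tmul a m =>
    rw [toOverlapTensor_tmul, hf, tensorStalkMap,
      Algebra.TensorProduct.productMap_apply_tmul, map_one, one_mul]
    rfl
  | add a b ha hb =>
    rw [map_add, map_add, map_add, ha, hb]
    rfl

/-- Quasi-coherent sheaves are separated over a base with faithfully flat overlaps. -/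
theorem IsQuasiCoherent.isSeparatedOver (hM : M.IsQuasiCoherent)
    (hZ : HasFaithfullyFlatOverlaps A Z) : M.IsSeparatedOver A := by
  intro x z t ht
  have := hZ.overlap z x
  choose f hbc hf using exists_isBaseChange_overlap (A := A) z x hM
  refine (toOverlapTensor z x).injective ((Module.FaithfullyFlat.eq_zero_of_isBaseChange
    (fun w : OModule.overlap z x => ((OModule.overlap z x).stalk w : Type u)) f hbc _
    fun w => ?_).trans (map_zero _).symm)
  exact (eq_smulMap_of_overlap z x w (f w) (hf w) t).trans (ht w.1 w.2.2 w.2.1)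

/-- The map `O_x ⊗_A M_z → lim_{w ≥ z, x} M_w` is surjective for quasi-coherent `M`. -/
theorem IsQuasiCoherent.exists_smulMap_eq (hM : M.IsQuasiCoherent)
    (hZ : HasFaithfullyFlatOverlaps A Z) (s : ∀ w : OModule.overlap z x, M.obj w.1)
    (hs : ∀ (v w : OModule.overlap z x) (h : v ≤ w), M.res (show v.1 ≤ w.1 from h) (s v) = s w) :
    ∃ t : Z.stalk x ⊗[A] M.obj z, ∀ w : OModule.overlap z x,
      smulMap A M w.2.2 w.2.1 t = s w := by
  have := hZ.overlap z x
  choose f hbc hf using exists_isBaseChange_overlap (A := A) z x hM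
  -- Descent is applied on the overlap poset with base ring `O_z ⊗_A O_x` and module `(O_z ⊗_A O_x)
  -- ⊗_{O_z} M_z`, which is `O_x ⊗_A M_z`.
  obtain ⟨n, hn⟩ := ((hM.isSeparatedOver hZ).overlap z x).exists_eq_of_mem_sectionsOver f hbc
    (fun v w h n => by
      obtain ⟨t, rfl⟩ := (toOverlapTensor z x).surjective n
      rw [eq_smulMap_of_overlap z x v (f v) (hf v), eq_smulMap_of_overlap z x w (f w) (hf w)]
      exact res_smulMap A M v.2.2 v.2.1 h t) s hs
  obtain ⟨t, rfl⟩ := (toOverlapTensor z x).surjective n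
  exact ⟨t, fun w => (eq_smulMap_of_overlap z x w (f w) (hf w) t).symm.trans (hn w)⟩

/-- Over a base with faithfully flat overlaps, the counit `O_x ⊗_A lim M → M_x` is an isomorphism
for quasi-coherent `M`. -/
theorem IsQuasiCoherent.isBaseChange_evalOver (hM : M.IsQuasiCoherent)
    (hZ : HasFaithfullyFlatOverlaps A Z) [Module.Flat A (Z.stalk x)] :
    IsBaseChange (Z.stalk x) (evalOver A M x) := by
  have hsep := hM.isSeparatedOver hZ
  have hlift (t : Z.stalk x ⊗[A] M.sectionsOver A) :
      TensorProduct.lift (((Algebra.linearMap (Z.stalk x)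
        (Module.End (Z.stalk x) (M.sectionsOver A →ₗ[A] M.obj x))).flip
          (evalOver A M x)).restrictScalars A) t =
        smulMap A M le_rfl le_rfl ((evalOver A M x).lTensor _ t) := by
    induction t using TensorProduct.induction_on with
    | zero => simp only [map_zero]
    | tmul a s =>
      rw [LinearMap.lTensor_tmul, smulMap_tmul_self]
      rfl
    | add a b ha hb => simp only [map_add, ha, hb]
  refine ⟨(injective_iff_map_eq_zero _).2 fun t ht =>
    hsep.counit_injective x t ((hlift t).symm.trans ht), fun m => ?_⟩
  -- The restrictions of `m` to the `w ≥ z, x` glue to an element `t z` of `O_x ⊗_A M_z`; these are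
  -- to be the components of a preimage of `m` in `O_x ⊗_A lim M`.
  choose t ht using fun z => hM.exists_smulMap_eq z x hZ (fun w => M.res w.2.2 m)
    (fun v w h => M.res_res _ _ m)
  obtain ⟨tt, htt⟩ := TensorProduct.exists_lTensor_proj (R := A) (Z.stalk x) M.obj t
  -- The index set of equations is the set of pairs `y ≤ z`. The `t z` satisfy them by
  -- separatedness: in each `M_w` both sides become the restriction of `m`.
  obtain ⟨s, rfl⟩ := Module.Flat.exists_lTensor_subtype (κ := {p : Z × Z // p.1 ≤ p.2})
    (Z.stalk x) (fun p => M.obj p.1.2)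
    (fun p => resLinear A M p.2 ∘ₗ LinearMap.proj p.1.1 - LinearMap.proj p.1.2)
    (M.sectionsOver A) (fun s hs y z h => sub_eq_zero.1 (hs ⟨(y, z), h⟩)) tt (fun p => by
      rw [LinearMap.lTensor_sub, LinearMap.lTensor_comp, LinearMap.sub_apply,
        LinearMap.comp_apply, htt, htt]
      refine hsep x p.1.2 _ fun w hx hz => ?_
      rw [map_sub, smulMap_lTensor_res, sub_eq_zero]
      exact (ht p.1.1 ⟨w, p.2.trans hz, hx⟩).trans (ht p.1.2 ⟨w, hz, hx⟩).symm)
  refine ⟨s, (hlift s).trans ?_⟩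
  have h1 : (evalOver A M x).lTensor (Z.stalk x) s = t x := by
    rw [← htt, ← LinearMap.comp_apply, ← LinearMap.lTensor_comp]
    rfl
  rw [h1]
  exact (ht x ⟨x, le_rfl, le_rfl⟩).trans (M.res_refl m)

end Tensor

end OModule

/-! ### The criterion for `Mod`-affineness -/

theorem RingHom.FaithfullyFlat.of_comp_surjective {R S T : Type u} [CommRing R] [CommRing S]
    [CommRing T] {p : R →+* S} {g : S →+* T} (h : (g.comp p).FaithfullyFlat)
    (hp : Function.Surjective p) : g.FaithfullyFlat := by
  have hb : Function.Bijective p := ⟨fun a b hab => h.injective (congrArg g hab), hp⟩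
  have h1 : g = (g.comp p).comp ((RingEquiv.ofBijective p hb).symm : S →+* R) := by
    ext s
    obtain ⟨r, rfl⟩ := hp s
    have : (RingEquiv.ofBijective p hb).symm (p r) = r :=
      (RingEquiv.ofBijective p hb).symm_apply_apply r
    simp [this]
  rw [h1]
  have h2 : ((RingEquiv.ofBijective p hb).symm : S →+* R).FaithfullyFlat :=
    .of_bijective (RingEquiv.ofBijective p hb).symm.bijective
  apply RingHom.FaithfullyFlat.stableUnderComposition
  exacts [h2, h]

namespace RingedPoset

/-- Faithful flatness of overlaps passes from `R` to an `R`-algebra `A`. -/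
theorem HasFaithfullyFlatOverlaps.of_isScalarTower (R A : Type u) [CommRing R] [CommRing A]
    [Algebra R A] {Z : RingedPoset.{u}} [∀ z : Z, Algebra R (Z.stalk z)]
    [∀ z : Z, Algebra A (Z.stalk z)] [IsOver R Z] [IsOver A Z]
    [∀ z : Z, IsScalarTower R A (Z.stalk z)] (h : HasFaithfullyFlatOverlaps R Z) :
    HasFaithfullyFlatOverlaps A Z := by
  intro z x
  -- The overlap map over `R` factors through the surjection `O_z ⊗_R O_x → O_z ⊗_A O_x`. A
  -- faithfully flat composite is injective, so this surjection is an isomorphism.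
  refine RingHom.FaithfullyFlat.of_comp_surjective
    (p := (Algebra.TensorProduct.mapOfCompatibleSMul A R R (Z.stalk z) (Z.stalk x)).toRingHom) ?_
    (TensorProduct.mapOfCompatibleSMul_surjective A R R (Z.stalk z) (Z.stalk x))
  convert h z x using 1
  refine RingHom.ext fun t => funext fun w => ?_
  induction t using TensorProduct.induction_on with
  | zero => simp only [map_zero]
  | tmul a b => rfl
  | add a b ha hb => simp only [map_add, Pi.add_apply, ha, hb]

end RingedPoset

namespace OModule

/-- The structure sheaf as a sheaf of modules over itself. -/
def structureSheaf (Z : RingedPoset.{u}) : OModule Z where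
  obj z := Z.stalk z
  res h :=
    { toFun := (Z.res h).hom
      map_add' := map_add _
      map_smul' := fun a b => map_mul (Z.res h).hom a b }
  res_refl {x} m := congrArg (fun φ : Z.stalk x ⟶ Z.stalk x => φ.hom m) (CData.res_refl Z le_rfl)
  res_res {x _ z} h h' m :=
    congrArg (fun φ : Z.stalk x ⟶ Z.stalk z => φ.hom m) (CData.res_res Z h h')

theorem isQuasiCoherent_structureSheaf (Z : RingedPoset.{u}) :
    (structureSheaf Z).IsQuasiCoherent := fun {x y} h => by
  let : Algebra (Z.stalk x) (Z.stalk y) := (Z.res h).hom.toAlgebra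
  let f : Z.stalk x →ₛₗ[(Z.res h).hom] Z.stalk y :=
    { toFun := (Z.res h).hom
      map_add' := map_add _
      map_smul' := fun a b => map_mul (Z.res h).hom a b }
  exact (isBaseChangeAlong_iff f (fun _ => rfl) (Algebra.linearMap (Z.stalk x) (Z.stalk y))
    fun _ => rfl).2 (IsBaseChange.linearMap (Z.stalk x) (Z.stalk y))

instance (Z : RingedPoset.{u}) : RingedPoset.IsOver Z.sections Z := ⟨fun h a => a.2 _ _ h⟩

theorem isQuasiCoherent_pullback (Z : RingedPoset.{u}) (N : Type u) [AddCommGroup N]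
    [Module Z.sections N] : (pullback Z N).IsQuasiCoherent := fun {x y} h => by
  let : Algebra (Z.stalk x) (Z.stalk y) := (Z.res h).hom.toAlgebra
  have : IsScalarTower Z.sections (Z.stalk x) (Z.stalk y) :=
    IsScalarTower.of_algebraMap_eq fun r => (r.2 x y h).symm
  let f : Z.stalk x ⊗[Z.sections] N →ₛₗ[(Z.res h).hom] Z.stalk y ⊗[Z.sections] N :=
    { toFun := (Z.resLinear h).rTensor N
      map_add' := map_add _
      map_smul' := ((pullback Z N).res h).map_smulₛₗ }
  let f' : Z.stalk x ⊗[Z.sections] N →ₗ[Z.stalk x] Z.stalk y ⊗[Z.sections] N :=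
    { toFun := f
      map_add' := map_add _
      map_smul' := fun r t => (f.map_smulₛₗ r t).trans (algebraMap_smul (Z.stalk y) r (f t)) }
  have h1 := TensorProduct.isBaseChange Z.sections N (Z.stalk x)
  have h2 := TensorProduct.isBaseChange Z.sections N (Z.stalk y)
  refine (isBaseChangeAlong_iff f (fun _ => rfl) f' fun _ => rfl).2 (IsBaseChange.of_comp h1 ?_)
  have e : f'.restrictScalars Z.sections ∘ₗ TensorProduct.mk Z.sections (Z.stalk x) N 1 =
      TensorProduct.mk Z.sections (Z.stalk y) N 1 :=
    LinearMap.ext fun n => congrArg (· ⊗ₜ[Z.sections] n) (map_one (Z.res h).hom)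
  rw [e]
  exact h2

end OModule

namespace RingedPoset

/-- This is descent for the structure sheaf with `N = A`. -/
theorem bijective_of_faithfullyFlatOverlaps (A : Type u) [CommRing A] {Z : RingedPoset.{u}}
    [∀ z : Z, Algebra A (Z.stalk z)] [IsOver A Z]
    [Module.FaithfullyFlat A (∀ z : Z, Z.stalk z)] (hZ : HasFaithfullyFlatOverlaps A Z)
    (φ : A →+* Z.sections) (hφ : ∀ a z, (φ a).1 z = algebraMap A (Z.stalk z) a) :
    Function.Bijective φ := by
  let (z : Z) : Module A ((OModule.structureSheaf Z).obj z) :=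
    inferInstanceAs (Module A (Z.stalk z))
  have (z : Z) : IsScalarTower A (Z.stalk z) ((OModule.structureSheaf Z).obj z) :=
    inferInstanceAs (IsScalarTower A (Z.stalk z) (Z.stalk z))
  have hbc (z : Z) := IsBaseChange.linearMap A (Z.stalk z)
  constructor
  · rw [injective_iff_map_eq_zero]
    refine fun a ha => Module.FaithfullyFlat.eq_zero_of_isBaseChange
      (fun z : Z => (Z.stalk z : Type u)) (fun z => Algebra.linearMap A (Z.stalk z)) hbc a
      fun z => ?_
    refine (hφ a z).symm.trans ?_
    rw [ha]
    rfl
  · intro s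
    have hqc : (OModule.structureSheaf Z).IsQuasiCoherent :=
      OModule.isQuasiCoherent_structureSheaf Z
    obtain ⟨a, ha⟩ := (hqc.isSeparatedOver hZ).exists_eq_of_mem_sectionsOver (fun z => Algebra.linearMap A (Z.stalk z)) hbc
      (fun x y h a => IsOver.res_algebraMap h a) s.1 s.2
    exact ⟨a, Subtype.ext (funext fun z => (hφ a z).trans (ha z))⟩

theorem isModAffine_of_sections {Z : RingedPoset.{u}}
    [Module.FaithfullyFlat Z.sections (∀ z : Z, Z.stalk z)]
    (hZ : HasFaithfullyFlatOverlaps Z.sections Z) : IsModAffine Z where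
  unit N _ _ := by
    let (z : Z) : Module Z.sections ((OModule.pullback Z N).obj z) :=
      inferInstanceAs (Module Z.sections (Z.stalk z ⊗[Z.sections] N))
    have (z : Z) : IsScalarTower Z.sections (Z.stalk z) ((OModule.pullback Z N).obj z) :=
      inferInstanceAs (IsScalarTower Z.sections (Z.stalk z) (Z.stalk z ⊗[Z.sections] N))
    have hbc (z : Z) := TensorProduct.isBaseChange Z.sections N (Z.stalk z)
    constructor
    · intro m n hmn
      refine sub_eq_zero.1 (Module.FaithfullyFlat.eq_zero_of_isBaseChange
        (fun z : Z => (Z.stalk z : Type u)) (fun z => TensorProduct.mk Z.sections (Z.stalk z) N 1)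
        hbc (m - n) fun z => ?_)
      rw [map_sub, sub_eq_zero]
      exact congrFun (congrArg Subtype.val hmn) z
    · intro s
      have hqc : (OModule.pullback Z N).IsQuasiCoherent := OModule.isQuasiCoherent_pullback Z N
      obtain ⟨n, hn⟩ := (hqc.isSeparatedOver hZ).exists_eq_of_mem_sectionsOver (fun z => TensorProduct.mk Z.sections (Z.stalk z) N 1)
        hbc (fun x y h n => ((OModule.unit Z N n).2 x y h)) s.1 s.2
      exact ⟨n, Subtype.ext (funext fun z => hn z)⟩
  counit M hM x := by
    let (z : Z) : Module Z.sections (M.obj z) := Module.compHom (M.obj z) (Z.eval z)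
    have (z : Z) : IsScalarTower Z.sections (Z.stalk z) (M.obj z) :=
      ⟨fun r s m => mul_smul (Z.eval z r) s m⟩
    have := Module.FaithfullyFlat.flat_of_pi (R := Z.sections)
      (fun z : Z => (Z.stalk z : Type u)) x
    have h1 := hM.isBaseChange_evalOver x hZ
    let e : M.sections ≃ₗ[Z.sections] M.sectionsOver Z.sections :=
      { toFun := fun s => ⟨s.1, s.2⟩
        invFun := fun s => ⟨s.1, s.2⟩
        map_add' := fun _ _ => rfl
        map_smul' := fun _ _ => rfl
        left_inv := fun _ => rfl
        right_inv := fun _ => rfl }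
    exact (isBaseChangeAlong_iff (M.eval x) (fun _ => rfl)
      (OModule.evalOver Z.sections M x ∘ₗ e.toLinearMap) fun _ => rfl).2
      (IsBaseChange.comp_equiv e _ h1)

theorem isModAffine_of_faithfullyFlatOverlaps (A : Type u) [CommRing A] {Z : RingedPoset.{u}}
    [∀ z : Z, Algebra A (Z.stalk z)] [IsOver A Z]
    [Module.FaithfullyFlat A (∀ z : Z, Z.stalk z)] (hZ : HasFaithfullyFlatOverlaps A Z)
    (φ : A →+* Z.sections) (hφ : ∀ a z, (φ a).1 z = algebraMap A (Z.stalk z) a) :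
    IsModAffine Z := by
  let : Algebra A Z.sections := φ.toAlgebra
  have (z : Z) : IsScalarTower A Z.sections (Z.stalk z) :=
    IsScalarTower.of_algebraMap_eq fun a => (hφ a z).symm
  -- `φ` identifies `A` with the ring of global sections, so both hypotheses transfer to the ring
  -- over which `Mod`-affineness is defined.
  have hff : Module.FaithfullyFlat Z.sections (∀ z : Z, Z.stalk z) := by
    rw [← RingHom.faithfullyFlat_algebraMap_iff]
    refine RingHom.FaithfullyFlat.of_comp_surjective (p := φ) ?_
      (bijective_of_faithfullyFlatOverlaps A hZ φ hφ).2
    have h1 : (algebraMap Z.sections (∀ z : Z, Z.stalk z)).comp φ =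
        algebraMap A (∀ z : Z, Z.stalk z) := RingHom.ext fun a => funext fun z => hφ a z
    rw [h1, RingHom.faithfullyFlat_algebraMap_iff]
    infer_instance
  exact isModAffine_of_sections (.of_isScalarTower A Z.sections hZ)

end RingedPoset

/-! ### Flatness and epimorphisms for pushouts of rings -/

theorem RingHom.pi_flat {R : Type*} [CommRing R] {ι : Type*} [_root_.Finite ι] {S : ι → Type*}
    [∀ i, CommRing (S i)] (φ : ∀ i, R →+* S i) (h : ∀ i, (φ i).Flat) : (RingHom.pi φ).Flat := by
  let (i : ι) : Algebra R (S i) := (φ i).toAlgebra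
  have (i : ι) : Module.Flat R (S i) := h i
  have h1 : Module.Flat R (∀ i, S i) := by
    cases nonempty_fintype ι
    classical
    exact Module.Flat.of_linearEquiv (DirectSum.linearEquivFunOnFintype R ι S).symm
  exact (RingHom.flat_algebraMap_iff (R := R) (S := ∀ i, S i)).2 h1

theorem RingHom.FaithfullyFlat.pi_reindex {R : Type u} [CommRing R] {ι κ : Type u} {S : ι → Type u}
    [∀ i, CommRing (S i)] {φ : ∀ i, R →+* S i} (h : (RingHom.pi φ).FaithfullyFlat) (e : κ → ι)
    (he : Function.Bijective e) : (RingHom.pi fun k => φ (e k)).FaithfullyFlat := by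
  let g : (∀ i, S i) →+* (∀ k, S (e k)) := RingHom.pi fun k => Pi.evalRingHom S (e k)
  have hg : Function.Bijective g := (Equiv.piCongrLeft S (Equiv.ofBijective e he)).symm.bijective
  have h2 : g.FaithfullyFlat := .of_bijective hg
  have h3 : RingHom.pi (fun k => φ (e k)) = g.comp (RingHom.pi φ) := rfl
  rw [h3]
  apply RingHom.FaithfullyFlat.stableUnderComposition
  exacts [h, h2]

namespace CommRingCat

/-- Since `φ` is an epimorphism, `S ⊗_R T` is `T`, and so `ψ` is the base change of `φ ≫ ψ` along
`φ`. -/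
theorem flat_of_epi_comp {R S T : CommRingCat.{u}} (φ : R ⟶ S) [Epi φ] (ψ : S ⟶ T)
    (h : (φ ≫ ψ).hom.Flat) : ψ.hom.Flat := by
  have h1 : (pushout.inl φ (φ ≫ ψ)).hom.Flat :=
    RingHom.Flat.isStableUnderBaseChange.pushout_inl RingHom.Flat.respectsIso φ (φ ≫ ψ) h
  have h2 : ψ ≫ pushout.inr φ (φ ≫ ψ) = pushout.inl φ (φ ≫ ψ) := by
    rw [← cancel_epi φ, ← Category.assoc, ← pushout.condition]
  let d : pushout φ (φ ≫ ψ) ⟶ T := pushout.desc ψ (𝟙 T) (by simp)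
  have hd : pushout.inl φ (φ ≫ ψ) ≫ d = ψ := pushout.inl_desc _ _ _
  have hd' : pushout.inr φ (φ ≫ ψ) ≫ d = 𝟙 T := pushout.inr_desc _ _ _
  have : IsIso d := ⟨pushout.inr _ _, by
    apply pushout.hom_ext
    · rw [reassoc_of% hd, h2, Category.comp_id]
    · rw [reassoc_of% hd', Category.comp_id], hd'⟩
  rw [← hd]
  exact h1.comp (.of_bijective (ConcreteCategory.bijective_of_isIso d))

/-- The map factors as `S ⊗_R T → S' ⊗_R T → S' ⊗_R T'`, two base changes of flat maps, and `S' ⊗_R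
T' = S' ⊗_{R'} T'` because `R → R'` is an epimorphism. -/
theorem flat_pushout_map {R S T R' S' T' : CommRingCat.{u}} (a : R ⟶ S) (b : R ⟶ T)
    (a' : R' ⟶ S') (b' : R' ⟶ T') (i : S ⟶ S') (j : T ⟶ T') (k : R ⟶ R') [Epi k]
    (h : a ≫ i = k ≫ a') (h' : b ≫ j = k ≫ b') (hi : i.hom.Flat) (hj : j.hom.Flat) :
    (pushout.map a b a' b' i j k h h').hom.Flat := by
  have hb := RingHom.Flat.isStableUnderBaseChange
  have hu := hb.pushout_inl RingHom.Flat.respectsIso (pushout.inl a b) i hi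
  have cu := pushout.condition (f := pushout.inl a b) (g := i)
  have du := @pushout.hom_ext _ _ _ _ _ (pushout.inl a b) i _
  have desc_u := fun {W : CommRingCat.{u}} (s : pushout a b ⟶ W) (t : S' ⟶ W)
    (w : pushout.inl a b ≫ s = i ≫ t) =>
      (⟨pushout.desc s t w, pushout.inl_desc _ _ _, pushout.inr_desc _ _ _⟩ :
        ∃ l : pushout (pushout.inl a b) i ⟶ W, pushout.inl _ _ ≫ l = s ∧ pushout.inr _ _ ≫ l = t)
  generalize pushout.inl (pushout.inl a b) i = u at *
  generalize pushout.inr (pushout.inl a b) i = u' at *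
  have hv := hb.pushout_inl RingHom.Flat.respectsIso (pushout.inr a b ≫ u) j hj
  have cv := pushout.condition (f := pushout.inr a b ≫ u) (g := j)
  have dv := @pushout.hom_ext _ _ _ _ _ (pushout.inr a b ≫ u) j _
  have desc_v := fun {W : CommRingCat.{u}} (s : pushout (pushout.inl a b) i ⟶ W) (t : T' ⟶ W)
    (w : (pushout.inr a b ≫ u) ≫ s = j ≫ t) =>
      (⟨pushout.desc s t w, pushout.inl_desc _ _ _, pushout.inr_desc _ _ _⟩ :
        ∃ l : pushout (pushout.inr a b ≫ u) j ⟶ W,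
          pushout.inl _ _ ≫ l = s ∧ pushout.inr _ _ ≫ l = t)
  generalize pushout.inl (pushout.inr a b ≫ u) j = v at *
  generalize pushout.inr (pushout.inr a b ≫ u) j = v' at *
  have m1 : pushout.inl a b ≫ pushout.map a b a' b' i j k h h' = i ≫ pushout.inl a' b' :=
    pushout.inl_desc _ _ _
  have m2 : pushout.inr a b ≫ pushout.map a b a' b' i j k h h' = j ≫ pushout.inr a' b' :=
    pushout.inr_desc _ _ _
  obtain ⟨d, hd, hd'⟩ := desc_u _ _ m1
  obtain ⟨d, rfl, hd2⟩ := desc_v d (pushout.inr a' b') (by rw [Category.assoc, hd, m2])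
  -- Only here is `k` being an epimorphism needed: the iterated pushout over `R` receives a map from
  -- the pushout over `R'`, inverse to `d`.
  have ce : a' ≫ u' ≫ v = b' ≫ v' := by
    rw [← cancel_epi k, ← reassoc_of% h, ← reassoc_of% h', ← cv, ← reassoc_of% cu,
      pushout.condition_assoc, Category.assoc]
  have he := pushout.inl_desc (f := a') (g := b') _ _ ce
  have he' := pushout.inr_desc (f := a') (g := b') _ _ ce
  generalize pushout.desc _ _ ce = e at he he'
  have : IsIso d := ⟨e, by
    apply dv
    · rw [Category.comp_id]
      apply du
      · rw [reassoc_of% hd]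
        apply pushout.hom_ext
        · rw [reassoc_of% m1, he, ← reassoc_of% cu]
        · rw [reassoc_of% m2, he', ← cv, Category.assoc]
      · rw [reassoc_of% hd', he]
    · rw [reassoc_of% hd2, he', Category.comp_id], by
    apply pushout.hom_ext
    · rw [reassoc_of% he, hd', Category.comp_id]
    · rw [reassoc_of% he', hd2, Category.comp_id]⟩
  rw [← hd]
  exact hu.comp (hv.comp (.of_bijective (ConcreteCategory.bijective_of_isIso d)))

theorem epi_pushout_map {R S T R' S' T' : CommRingCat.{u}} (a : R ⟶ S) (b : R ⟶ T)
    (a' : R' ⟶ S') (b' : R' ⟶ T') (i : S ⟶ S') (j : T ⟶ T') (k : R ⟶ R')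
    (h : a ≫ i = k ≫ a') (h' : b ≫ j = k ≫ b') [Epi i] [Epi j] :
    Epi (pushout.map a b a' b' i j k h h') := ⟨fun f g hfg => by
  apply pushout.hom_ext
  · have := congrArg (pushout.inl a b ≫ ·) hfg
    simpa only [pushout.inl_desc_assoc, pushout.map, Category.assoc, cancel_epi] using this
  · have := congrArg (pushout.inr a b ≫ ·) hfg
    simpa only [pushout.inr_desc_assoc, pushout.map, Category.assoc, cancel_epi] using this⟩

/-- The two coprojections `A → A ⊗_R A` have the same composites to the `D i`, so injectivity makes
them equal. -/
theorem epi_of_injective_tensorToProd {R A : CommRingCat.{u}} (φ : R ⟶ A) {ι : Type u}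
    (D : ι → CommRingCat.{u}) (a : ∀ i, A ⟶ D i)
    (h : Function.Injective (tensorToProd φ φ D a a fun _ => rfl)) : Epi φ := ⟨fun g g' hg => by
  have h1 : pushout.inl φ φ = pushout.inr φ φ := by
    ext x
    refine h (funext fun i => ?_)
    refine Eq.trans (b := (a i).hom x) ?_ (Eq.symm ?_)
    · exact congrArg (fun ψ : A ⟶ D i => ψ.hom x) (pushout.inl_desc _ _ _)
    · exact congrArg (fun ψ : A ⟶ D i => ψ.hom x) (pushout.inr_desc _ _ _)
  have h2 := congrArg (· ≫ pushout.desc g g' hg) h1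
  exact (pushout.inl_desc _ _ _).symm.trans (h2.trans (pushout.inr_desc _ _ _))⟩

end CommRingCat

/-! ### Consequences of schematicity -/

namespace RingedPoset

/-- The epimorphism property comes from the overlap condition with `x = y`. -/
theorem IsSchematic.isPseudoSchematic {X : RingedPoset.{u}} (hX : X.IsSchematic) :
    X.IsPseudoSchematic := fun h =>
  ⟨hX.flat h, CommRingCat.epi_of_injective_tensorToProd _ _ _ (hX.faithfullyFlat h h).injective⟩

theorem isPseudoSchematic_fiberProduct {F G H : RingedPoset.{u}} (f : F ⟶ H) (g : G ⟶ H)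
    (hF : F.IsPseudoSchematic) (hG : G.IsPseudoSchematic) (hH : H.IsPseudoSchematic) :
    IsPseudoSchematic (CData.fiberProduct f g) := fun {w w'} h => by
  have h1 : w.1.1 ≤ w'.1.1 := h.1
  have h2 : w.1.2 ≤ w'.1.2 := h.2
  have i1 : Epi (F.res h1) := (hF h1).2
  have i2 : Epi (G.res h2) := (hG h2).2
  have i3 : Epi (H.res (f.base.monotone h1)) := (hH (f.base.monotone h1)).2
  have e := CData.fiberProduct_square f g w.2 w'.2 h1 h2
  exact ⟨CommRingCat.flat_pushout_map _ _ _ _ _ _ (H.res (f.base.monotone h1)) e.1 e.2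
    (hF h1).1 (hG h2).1, CommRingCat.epi_pushout_map _ _ _ _ _ _ _ e.1 e.2⟩

/-- For a schematic morphism, `O_{X,x} ⊗_{O_{Y,f(x)}} O_{Y,y} → ∏_{z ∈ U_x ∩ f⁻¹(U_y)} O_{X,z}` is
faithfully flat. -/
theorem IsSchematicHom.faithfullyFlat {X Y : RingedPoset.{u}} {f : X ⟶ Y} (hf : IsSchematicHom f)
    (hX : X.IsSchematic) (hY : Y.IsSchematic) (x : X) (y : Y) (h : f.base x ≤ y) :
    (tensorToProd (f.sharp x) (Y.res h)
      (fun z : {z : X // x ≤ z ∧ y ≤ f.base z} => X.stalk z.1)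
      (fun z => X.res z.2.1) (fun z => f.toLE z.2.2)
      (fun z => (f.naturality z.2.1).symm.trans (CData.res_toLE f h z.2.2).symm)).FaithfullyFlat := by
  rw [RingHom.FaithfullyFlat.iff_flat_and_comap_surjective]
  refine ⟨RingHom.pi_flat _ fun z => ?_, hf x y h⟩
  have := (hY.isPseudoSchematic h).2
  -- `O_{X,x} → O_{X,x} ⊗ O_{Y,y}` is an epimorphism, as a pushout of a restriction map of `Y`, and
  -- its composite to `O_{X,z}` is a restriction map of `X`.
  refine CommRingCat.flat_of_epi_comp (pushout.inl (f.sharp x) (Y.res h))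
    (pushout.desc (X.res z.2.1) (f.toLE z.2.2) _) ?_
  rw [pushout.inl_desc]
  exact hX.flat _

/-- Passes from the categorical pushout in `IsSchematic` to the algebraic tensor product used in
`HasFaithfullyFlatOverlaps`. -/
theorem IsSchematic.faithfullyFlat_productMap {X : RingedPoset.{u}} (hX : X.IsSchematic)
    {t x y : X} (hx : t ≤ x) (hy : t ≤ y) [Algebra (X.stalk t) (X.stalk x)]
    [Algebra (X.stalk t) (X.stalk y)]
    (ex : algebraMap (X.stalk t) (X.stalk x) = (X.res hx).hom)
    (ey : algebraMap (X.stalk t) (X.stalk y) = (X.res hy).hom)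
    (m : ∀ z : {z : X // x ≤ z ∧ y ≤ z}, X.stalk x ⊗[X.stalk t] X.stalk y →+* X.stalk z.1)
    (hm : ∀ z a b, m z (a ⊗ₜ b) = (X.res z.2.1).hom a * (X.res z.2.2).hom b) :
    (RingHom.pi m).FaithfullyFlat := by
  have hp := CommRingCat.isPushout_tensorProduct (X.stalk t) (X.stalk x) (X.stalk y)
  have hff := hX.faithfullyFlat hx hy
  have ex' : CommRingCat.ofHom (algebraMap (X.stalk t) (X.stalk x)) = X.res hx := by
    rw [ex, CommRingCat.ofHom_hom]
  have ey' : CommRingCat.ofHom (algebraMap (X.stalk t) (X.stalk y)) = X.res hy := by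
    rw [ey, CommRingCat.ofHom_hom]
  rw [ex', ey'] at hp
  let e := hp.isoPushout
  have h3 : RingHom.pi m = (tensorToProd (X.res hx) (X.res hy)
      (fun z : {z : X // x ≤ z ∧ y ≤ z} => X.stalk z.1)
      (fun z => X.res z.2.1) (fun z => X.res z.2.2)
      (fun z => by rw [CData.res_res, CData.res_res])).comp e.hom.hom := by
    refine RingHom.ext fun s => funext fun z => ?_
    let d := pushout.desc (f := X.res hx) (g := X.res hy) (X.res z.2.1) (X.res z.2.2)
      (by rw [CData.res_res, CData.res_res])
    have h4 : CommRingCat.ofHom (m z) = e.hom ≫ d := by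
      apply hp.hom_ext
      · rw [IsPushout.inl_isoPushout_hom_assoc, pushout.inl_desc]
        ext a
        exact (hm z a 1).trans (by rw [map_one, mul_one])
      · rw [IsPushout.inr_isoPushout_hom_assoc, pushout.inr_desc]
        ext a
        exact (hm z 1 a).trans (by rw [map_one, one_mul])
    exact congrArg (fun φ : CommRingCat.of (X.stalk x ⊗[X.stalk t] X.stalk y) ⟶ X.stalk z.1 =>
      φ.hom s) h4
  rw [h3]
  have h2 : e.hom.hom.FaithfullyFlat := .of_bijective (ConcreteCategory.bijective_of_isIso e.hom)
  apply RingHom.FaithfullyFlat.stableUnderComposition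
  exacts [h2, hff]

end RingedPoset

/-! ### Fibres of `ρ`, and the direct implication -/

namespace RingedPosetData

open CData RingedPoset

variable {X Y : RingedPosetData.{u}} (f : X ⟶ Y) (p : X) (q : Y) (h : f.base p ≤ q)

/-- The inclusion of the points of `Cyl(U)` in those of `Cyl(𝒳)`. -/
def cylIncl (U : Set X) (a : CylPt (X.restrict U)) : CylPt X := ⟨a.idx.1, a.pt⟩

theorem isPseudoSchematic_cyl_restrict (U : Set X) (hX : IsPseudoSchematic (cyl X)) :
    IsPseudoSchematic (cyl (X.restrict U)) := fun {a b} hab =>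
  hX (x := cylIncl U a) (y := cylIncl U b) hab

variable (w : fiberProduct (component f p) (Y.trans h))

/-- The preimage of the open star `U_w` under `ρ_{pq}`. -/
abbrev rhoFiber : RingedPoset.{u} :=
  (cyl (X.restrict (capPreimage f p q))).restrict {z | w ≤ (rho f p q h).base z}

/-- The point `x_p` of `Cyl(𝒳)`, for `w = (x, y)`. -/
abbrev fstPt : cyl X := (⟨p, w.1.1⟩ : CylPt X)

/-- The point `y_q` of `Cyl(𝒴)`, for `w = (x, y)`. -/
abbrev sndPt : cyl Y := (⟨q, w.1.2⟩ : CylPt Y)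

theorem cylMap_fstPt_le : (cylMap f).base (fstPt f p q h w) ≤ sndPt f p q h w := ⟨h, w.2.le⟩

/-- `ρ_{pq}⁻¹(U_w)` is identified with `U_{x_p} ∩ Cyl(f)⁻¹(U_{y_q})`. -/
def fiberIncl (z : rhoFiber f p q h w) :
    {z : cyl X // fstPt f p q h w ≤ z ∧ sndPt f p q h w ≤ (cylMap f).base z} :=
  ⟨cylIncl _ z.1, ⟨z.1.idx.2.1, z.2.1⟩, ⟨z.1.idx.2.2, z.2.2⟩⟩

theorem fiberIncl_bijective : Function.Bijective (fiberIncl f p q h w) := by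
  constructor
  · rintro ⟨⟨⟨r, hr⟩, a⟩, ha⟩ ⟨⟨⟨s, hs⟩, b⟩, hb⟩ hab
    have h1 : (⟨r, a⟩ : CylPt X) = ⟨s, b⟩ := congrArg Subtype.val hab
    cases h1
    rfl
  · rintro ⟨⟨r, a⟩, ⟨h1, h2⟩, ⟨h3, h4⟩⟩
    exact ⟨⟨⟨⟨r, h1, h3⟩, a⟩, h2, h4⟩, rfl⟩

/-- Because `f_p(x) = 𝒴_{pq}(y)`, the stalk at `w` is the pushout in the schematicity condition of
`Cyl(f)` at `(x_p, y_q)`; here the maps to `O_z` are matched as well. -/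
theorem toLE_rho (z : rhoFiber f p q h w) :
    (rho f p q h).toLE z.2 = pushout.desc (f := (cylMap f).sharp (fstPt f p q h w))
      (g := (cyl Y).res (cylMap_fstPt_le f p q h w))
      ((cyl X).res (fiberIncl f p q h w z).2.1) ((cylMap f).toLE (fiberIncl f p q h w z).2.2)
      (((cylMap f).naturality (fiberIncl f p q h w z).2.1).symm.trans
        (res_toLE (cylMap f) _ _).symm) := by
  apply pushout.hom_ext
  · refine Eq.trans ?_ (pushout.inl_desc _ _ _).symm
    refine (pushout.inl_desc_assoc _ _ _ _).trans ?_
    refine (Category.assoc _ _ _).trans ?_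
    exact congrArg (_ ≫ ·) (pushout.inl_desc _ _ _)
  · refine Eq.trans ?_ (pushout.inr_desc _ _ _).symm
    refine (pushout.inr_desc_assoc _ _ _ _).trans ?_
    refine (Category.assoc _ _ _).trans ?_
    refine (congrArg (_ ≫ ·) (pushout.inr_desc _ _ _)).trans ?_
    exact (Category.assoc _ _ _).symm

/-- `O_w` acts on the stalks of `ρ_{pq}⁻¹(U_w)`. -/
noncomputable abbrev rhoFiberAlgebra (z : rhoFiber f p q h w) :
    Algebra ((fiberProduct (component f p) (Y.trans h)).stalk w)
      ((rhoFiber f p q h w).stalk z) :=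
  ((rho f p q h).toLE z.2).hom.toAlgebra

/-- `O_{x_p}` acts on the stalks of `ρ_{pq}⁻¹(U_w)`. -/
abbrev rhoFiberAlgebraFst (z : rhoFiber f p q h w) :
    Algebra ((cyl X).stalk (fstPt f p q h w)) ((rhoFiber f p q h w).stalk z) :=
  ((cyl X).res (fiberIncl f p q h w z).2.1).hom.toAlgebra

attribute [local instance] rhoFiberAlgebra rhoFiberAlgebraFst

instance : IsOver ((fiberProduct (component f p) (Y.trans h)).stalk w)
    (rhoFiber f p q h w) := ⟨fun {z z'} hz a =>
  congrArg (fun φ : (fiberProduct (component f p) (Y.trans h)).stalk w ⟶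
    (rhoFiber f p q h w).stalk z' => φ.hom a) (toLE_res (rho f p q h) z.2 hz)⟩

instance : IsOver ((cyl X).stalk (fstPt f p q h w)) (rhoFiber f p q h w) := ⟨fun {z z'} hz a =>
  congrArg (fun φ : (cyl X).stalk (fstPt f p q h w) ⟶
    (rhoFiber f p q h w).stalk z' => φ.hom a) (res_res (cyl X) (fiberIncl f p q h w z).2.1
      (show (fiberIncl f p q h w z).1 ≤ (fiberIncl f p q h w z').1 from hz))⟩

theorem hasFaithfullyFlatOverlaps_fst (hX : IsSchematic (cyl X)) :
    HasFaithfullyFlatOverlaps ((cyl X).stalk (fstPt f p q h w)) (rhoFiber f p q h w) := by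
  intro z z'
  let i := fiberIncl f p q h w
  let : Algebra ((cyl X).stalk (fstPt f p q h w)) ((cyl X).stalk (i z).1) :=
    rhoFiberAlgebraFst f p q h w z
  let : Algebra ((cyl X).stalk (fstPt f p q h w)) ((cyl X).stalk (i z').1) :=
    rhoFiberAlgebraFst f p q h w z'
  let (v : {v : cyl X // (i z).1 ≤ v ∧ (i z').1 ≤ v}) :
      Algebra ((cyl X).stalk (fstPt f p q h w)) ((cyl X).stalk v.1) :=
    ((cyl X).res ((i z).2.1.trans v.2.1)).hom.toAlgebra
  let m (v : {v : cyl X // (i z).1 ≤ v ∧ (i z').1 ≤ v}) :=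
    (Algebra.TensorProduct.productMap
      { ((cyl X).res v.2.1).hom with
        commutes' := fun a => congrArg (fun φ : (cyl X).stalk (fstPt f p q h w) ⟶
          (cyl X).stalk v.1 => φ.hom a) (res_res (cyl X) (i z).2.1 v.2.1) }
      { ((cyl X).res v.2.2).hom with
        commutes' := fun a => congrArg (fun φ : (cyl X).stalk (fstPt f p q h w) ⟶
          (cyl X).stalk v.1 => φ.hom a) (res_res (cyl X) (i z').2.1 v.2.2) } :
      (cyl X).stalk (i z).1 ⊗[(cyl X).stalk (fstPt f p q h w)] (cyl X).stalk (i z').1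
        →ₐ[(cyl X).stalk (fstPt f p q h w)] (cyl X).stalk v.1).toRingHom
  have h1 := hX.faithfullyFlat_productMap (i z).2.1 (i z').2.1 rfl rfl m fun _ _ _ => rfl
  let e (v : {v : rhoFiber f p q h w // z ≤ v ∧ z' ≤ v}) :
      {v : cyl X // (i z).1 ≤ v ∧ (i z').1 ≤ v} := ⟨(i v.1).1, v.2.1, v.2.2⟩
  -- The fibre is an upper set, so `z` and `z'` have the same upper bounds in it as in `Cyl(𝒳)`.
  have he : Function.Bijective e := by
    constructor
    · intro v v' hv
      exact Subtype.ext ((fiberIncl_bijective f p q h w).1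
        (Subtype.ext (congrArg (fun t => t.1) hv :)))
    · rintro ⟨v, hv, hv'⟩
      obtain ⟨v', hv''⟩ := (fiberIncl_bijective f p q h w).2
        ⟨v, (i z).2.1.trans hv, (i z).2.2.trans ((cylMap f).base.monotone hv)⟩
      obtain rfl : (i v').1 = v := congrArg Subtype.val hv''
      exact ⟨⟨v', hv, hv'⟩, rfl⟩
  refine Eq.mp (congrArg RingHom.FaithfullyFlat
    (RingHom.ext fun a => funext fun v => ?_)) (h1.pi_reindex e he)
  induction a using TensorProduct.induction_on with
  | zero => exact (map_zero (m (e v))).trans (map_zero (tensorStalkMap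
    ((cyl X).stalk (fstPt f p q h w)) v.2.1 v.2.2)).symm
  | tmul a b => rfl
  | add a b ha hb =>
    exact (map_add (m (e v)) a b).trans ((congrArg₂ (· + ·) ha hb).trans
      (map_add (tensorStalkMap ((cyl X).stalk (fstPt f p q h w)) v.2.1 v.2.2) a b).symm)

theorem faithfullyFlat_rhoFiber (hf : IsSchematicHom (cylMap f)) (hX : IsSchematic (cyl X))
    (hY : IsSchematic (cyl Y)) :
    Module.FaithfullyFlat ((fiberProduct (component f p) (Y.trans h)).stalk w)
      (∀ z : rhoFiber f p q h w, (rhoFiber f p q h w).stalk z) := by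
  rw [← RingHom.faithfullyFlat_algebraMap_iff]
  have h1 := (hf.faithfullyFlat hX hY _ _ (cylMap_fstPt_le f p q h w)).pi_reindex _
    (fiberIncl_bijective f p q h w)
  refine Eq.mp (congrArg RingHom.FaithfullyFlat
    (RingHom.ext fun a => funext fun z => Eq.symm ?_)) h1
  exact congrArg (fun φ : (fiberProduct (component f p) (Y.trans h)).stalk w ⟶
    (rhoFiber f p q h w).stalk z => φ.hom a) (toLE_rho f p q h w z)

theorem isQcIso_rho (hX : X.IsSchFin) (hY : Y.IsSchFin) (hcX : IsSchematic (cyl X))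
    (hcY : IsSchematic (cyl Y)) (hf : IsSchematicHom (cylMap f)) : IsQcIso (rho f p q h) := by
  have hFF := fun w => faithfullyFlat_rhoFiber f p q h w hf hcX hcY
  -- Schematicity of `Cyl(𝒳)` gives overlaps over `O_{x_p}`; they are transferred along `O_{x_p} →
  -- O_w`.
  have hov (w) : HasFaithfullyFlatOverlaps ((fiberProduct (component f p) (Y.trans h)).stalk w)
      (rhoFiber f p q h w) := by
    let : Algebra ((cyl X).stalk (fstPt f p q h w))
        ((fiberProduct (component f p) (Y.trans h)).stalk w) :=
      (pushout.inl ((component f p).sharp w.1.1) ((Y.trans h).toLE w.2.le)).hom.toAlgebra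
    have (z : rhoFiber f p q h w) : IsScalarTower ((cyl X).stalk (fstPt f p q h w))
        ((fiberProduct (component f p) (Y.trans h)).stalk w) ((rhoFiber f p q h w).stalk z) :=
      IsScalarTower.of_algebraMap_eq fun a =>
        (congrArg (fun φ : (cyl X).stalk (fstPt f p q h w) ⟶ (rhoFiber f p q h w).stalk z =>
          φ.hom a) ((congrArg (pushout.inl _ _ ≫ ·) (toLE_rho f p q h w z)).trans
            (pushout.inl_desc _ _ _))).symm
    exact .of_isScalarTower ((cyl X).stalk (fstPt f p q h w)) _
      (hasFaithfullyFlatOverlaps_fst f p q h w hcX)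
  refine ⟨isPseudoSchematic_cyl_restrict _ hcX.isPseudoSchematic,
    isPseudoSchematic_fiberProduct _ _ (hX.obj p).isPseudoSchematic
      (hY.obj q).isPseudoSchematic (hY.obj _).isPseudoSchematic, fun w => ?_, fun w => ?_⟩
  · have := hFF w
    exact isModAffine_of_faithfullyFlatOverlaps
      ((fiberProduct (component f p) (Y.trans h)).stalk w) (hov w)
      (toPushforward (rho f p q h) w) fun _ _ => rfl
  · have := hFF w
    exact bijective_of_faithfullyFlatOverlaps
      ((fiberProduct (component f p) (Y.trans h)).stalk w) (hov w)
      (toPushforward (rho f p q h) w) fun _ _ => rfl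

end RingedPosetData

/-! ### Surjectivity on spectra through field-valued points -/

theorem exists_field_of_nontrivial_tensorProduct (R S k : Type u) [CommRing R] [CommRing S]
    [CommRing k] [Algebra R S] [Algebra R k] [Nontrivial (S ⊗[R] k)] :
    ∃ (k' : Type u) (_ : Field k') (c : S →+* k') (j : k →+* k'),
      c.comp (algebraMap R S) = j.comp (algebraMap R k) := by
  obtain ⟨m, hm⟩ := Ideal.exists_maximal (S ⊗[R] k)
  refine ⟨(S ⊗[R] k) ⧸ m, Ideal.Quotient.field m,
    (Ideal.Quotient.mk m).comp Algebra.TensorProduct.includeLeftRingHom,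
    (Ideal.Quotient.mk m).comp (Algebra.TensorProduct.includeRight : k →ₐ[R] S ⊗[R] k).toRingHom,
    ?_⟩
  ext r
  simp [Algebra.TensorProduct.algebraMap_apply]

namespace PrimeSpectrum

/-- Both `k` and the residue field of `P` contain the residue field of `ker a`; a residue field of
their tensor product over it serves as `k'`. -/
theorem exists_field_of_comap_eq {R S : Type u} [CommRing R] [CommRing S] (φ : R →+* S)
    (P : PrimeSpectrum S) (k : Type u) [Field k] (a : R →+* k)
    (h : (comap φ P).asIdeal = RingHom.ker a) :
    ∃ (k' : Type u) (_ : Field k') (c : S →+* k') (j : k →+* k'), c.comp φ = j.comp a := by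
  have := RingHom.ker_isPrime a
  let L := (RingHom.ker a).ResidueField
  let i : L →+* k := Ideal.ResidueField.lift (RingHom.ker a) a le_rfl fun r hr =>
    isUnit_iff_ne_zero.2 hr
  let i' : L →+* P.asIdeal.ResidueField := Ideal.ResidueField.map (RingHom.ker a) P.asIdeal φ h.symm
  let := i.toAlgebra
  let := i'.toAlgebra
  obtain ⟨k', hk', c, j, hcj⟩ := exists_field_of_nontrivial_tensorProduct L
    P.asIdeal.ResidueField k
  refine ⟨k', hk', c.comp (algebraMap S _), j, ?_⟩
  ext r
  have h1 : c (i' (algebraMap R L r)) = j (i (algebraMap R L r)) :=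
    congrArg (fun ψ => ψ (algebraMap R L r)) hcj
  have h2 : i (algebraMap R L r) = a r := Ideal.ResidueField.lift_algebraMap ..
  have h3 : i' (algebraMap R L r) = algebraMap S _ (φ r) := Ideal.ResidueField.map_algebraMap ..
  rwa [h2, h3] at h1

/-- Joint surjectivity on spectra in terms of points with values in fields. -/
theorem comap_pi_surjective_iff {R : Type u} [CommRing R] {ι : Type u} [Finite ι] {S : ι → Type u}
    [∀ i, CommRing (S i)] (φ : ∀ i, R →+* S i) :
    Function.Surjective (comap (RingHom.pi φ)) ↔ ∀ (k : Type u) [Field k] (a : R →+* k),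
      ∃ (i : ι) (k' : Type u) (_ : Field k') (c : S i →+* k') (j : k →+* k'),
        c.comp (φ i) = j.comp a := by
  constructor
  · intro hs k _ a
    obtain ⟨Q, hQ⟩ := hs ⟨RingHom.ker a, RingHom.ker_isPrime a⟩
    -- A prime of a finite product comes from one of the factors.
    obtain ⟨i, P, rfl⟩ := exists_comap_evalRingHom_eq Q
    exact ⟨i, exists_field_of_comap_eq (φ i) P k a (congrArg PrimeSpectrum.asIdeal hQ)⟩
  · intro H P
    obtain ⟨i, k', _, c, j, hcj⟩ := H P.asIdeal.ResidueField (algebraMap R _)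
    refine ⟨comap (c.comp (Pi.evalRingHom S i)) ⊥, ?_⟩
    ext r
    have h1 : c (φ i r) = j (algebraMap R _ r) := congrArg (fun ψ => ψ r) hcj
    change c (φ i r) = 0 ↔ _
    rw [h1, map_eq_zero]
    exact Ideal.algebraMap_residueField_eq_zero

end PrimeSpectrum

/-- A field point of the tensor product is a pair of points agreeing on `R`. In this form, liftings
along successive schematic maps can be chained. -/
theorem comap_tensorToProd_surjective_iff {R A B : CommRingCat.{u}} (φ : R ⟶ A) (ψ : R ⟶ B)
    {ι : Type u} [Finite ι] (D : ι → CommRingCat.{u}) (a : ∀ i, A ⟶ D i) (b : ∀ i, B ⟶ D i)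
    (h : ∀ i, φ ≫ a i = ψ ≫ b i) :
    Function.Surjective (PrimeSpectrum.comap (tensorToProd φ ψ D a b h)) ↔
      ∀ (k : Type u) [Field k] (s : A ⟶ CommRingCat.of k) (t : B ⟶ CommRingCat.of k),
        φ ≫ s = ψ ≫ t → ∃ (i : ι) (k' : Type u) (_ : Field k') (c : D i ⟶ CommRingCat.of k')
          (j : CommRingCat.of k ⟶ CommRingCat.of k'), a i ≫ c = s ≫ j ∧ b i ≫ c = t ≫ j := by
  unfold tensorToProd
  rw [PrimeSpectrum.comap_pi_surjective_iff]
  constructor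
  · intro H k _ s t hst
    obtain ⟨i, k', hk', c, j, hcj⟩ := H k (pushout.desc s t hst).hom
    have h1 : pushout.desc (a i) (b i) (h i) ≫ CommRingCat.ofHom c =
        pushout.desc s t hst ≫ CommRingCat.ofHom j := CommRingCat.hom_ext hcj
    refine ⟨i, k', hk', CommRingCat.ofHom c, CommRingCat.ofHom j, ?_, ?_⟩
    · simpa only [pushout.inl_desc_assoc] using congrArg (pushout.inl φ ψ ≫ ·) h1
    · simpa only [pushout.inr_desc_assoc] using congrArg (pushout.inr φ ψ ≫ ·) h1
  · intro H k _ s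
    obtain ⟨i, k', hk', c, j, h1, h2⟩ := H k (pushout.inl φ ψ ≫ CommRingCat.ofHom s)
      (pushout.inr φ ψ ≫ CommRingCat.ofHom s) (by rw [pushout.condition_assoc])
    refine ⟨i, k', hk', c.hom, j.hom, ?_⟩
    have h3 : pushout.desc (a i) (b i) (h i) ≫ c = CommRingCat.ofHom s ≫ j := by
      apply pushout.hom_ext
      · rw [pushout.inl_desc_assoc, h1, Category.assoc]
      · rw [pushout.inr_desc_assoc, h2, Category.assoc]
    exact congrArg CommRingCat.Hom.hom h3

/-! ### The converse implication -/

namespace RingedPosetData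

open CData RingedPoset

variable {X Y : RingedPosetData.{u}} (f : X ⟶ Y) (p : X) (q : Y) (h : f.base p ≤ q)

theorem exists_field_of_isQcIso (hq : IsQcIso (rho f p q h))
    (w : fiberProduct (component f p) (Y.trans h)) (k : Type u) [Field k]
    (d : (fiberProduct (component f p) (Y.trans h)).stalk w ⟶ CommRingCat.of k) :
    ∃ (z : rhoFiber f p q h w) (k' : Type u) (_ : Field k')
      (c : (rhoFiber f p q h w).stalk z ⟶ CommRingCat.of k')
      (j : CommRingCat.of k ⟶ CommRingCat.of k'), (rho f p q h).toLE z.2 ≫ c = d ≫ j := by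
  let e := RingEquiv.ofBijective _ (hq.bijective w)
  -- The isomorphism of `O_w` with the sections over the fibre makes `k` a module over these
  -- sections. Injectivity of the unit on `k` forces `1 ⊗ 1 ≠ 0` at some `z`.
  let φ : (rhoFiber f p q h w).sections →+* k := d.hom.comp (e.symm : _ →+* _)
  let : Algebra (rhoFiber f p q h w).sections k := φ.toAlgebra
  obtain ⟨z, hz⟩ : ∃ z : rhoFiber f p q h w,
      (1 : (rhoFiber f p q h w).stalk z) ⊗ₜ[(rhoFiber f p q h w).sections] (1 : k) ≠ 0 := by
    by_contra! H
    refine one_ne_zero (((hq.modAffine w).unit k).1 (a₁ := 1) (a₂ := 0)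
      (Subtype.ext (funext fun z => (H z).trans (TensorProduct.tmul_zero _ _).symm)))
  have : Nontrivial ((rhoFiber f p q h w).stalk z ⊗[(rhoFiber f p q h w).sections] k) :=
    ⟨_, _, hz⟩
  obtain ⟨k', hk', c, j, hcj⟩ := exists_field_of_nontrivial_tensorProduct
    (rhoFiber f p q h w).sections ((rhoFiber f p q h w).stalk z) k
  refine ⟨z, k', hk', CommRingCat.ofHom c, CommRingCat.ofHom j, ?_⟩
  ext r
  refine (congrArg (fun ψ => ψ (e r)) hcj).trans ?_
  exact congrArg (fun s => j (d.hom s)) (e.symm_apply_apply r)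

theorem cyl_res_of_idx_eq {x x' : (X.stalk p).unop} (hx : x ≤ x')
    (hle : (⟨p, x⟩ : CylPt X) ≤ ⟨p, x'⟩) :
    (cyl X).res (x := (⟨p, x⟩ : CylPt X)) (y := (⟨p, x'⟩ : CylPt X)) hle =
      (X.stalk p).unop.res hx :=
  (toLE_congr (trans_refl X le_rfl) _ hx).trans (toLE_id _ _)

/-- Only `f_p(x) ≤ 𝒴_{pq}(y)` is assumed, as in the order of the cylinder. The induction moves `(x,
y)` upwards until equality holds, and then the qc-isomorphism applies. -/
theorem exists_field_cyl (hY : Y.IsSchFin) (hf : IsSchFinHom f) (hq : IsQcIso (rho f p q h))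
    (w : (X.stalk p).unop × (Y.stalk q).unop)
    (hw : (component f p).base w.1 ≤ (Y.trans h).base w.2) (k : Type u) [Field k]
    (a : (X.stalk p).unop.stalk w.1 ⟶ CommRingCat.of k)
    (b : (Y.stalk q).unop.stalk w.2 ⟶ CommRingCat.of k)
    (hab : (component f p).sharp w.1 ≫ a = (Y.trans h).toLE hw ≫ b) :
    ∃ (z : cyl X) (hz : (⟨p, w.1⟩ : CylPt X) ≤ z)
      (hz' : (⟨q, w.2⟩ : CylPt Y) ≤ (cylMap f).base z) (k' : Type u) (_ : Field k')
      (c : (cyl X).stalk z ⟶ CommRingCat.of k') (j : CommRingCat.of k ⟶ CommRingCat.of k'),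
      (cyl X).res (x := (⟨p, w.1⟩ : CylPt X)) hz ≫ c = a ≫ j ∧
        (cylMap f).toLE (x := (⟨q, w.2⟩ : CylPt Y)) hz' ≫ c = b ≫ j := by
  induction w using WellFoundedGT.induction generalizing k with
  | ind w IH =>
  by_cases e : (component f p).base w.1 = (Y.trans h).base w.2
  · obtain ⟨z, k', hk', c, j, hcj⟩ := exists_field_of_isQcIso f p q h hq ⟨w, e⟩ k
      (pushout.desc a b hab)
    have h1 := (congrArg (· ≫ c) (toLE_rho f p q h ⟨w, e⟩ z)).symm.trans hcj
    refine ⟨(fiberIncl f p q h ⟨w, e⟩ z).1, (fiberIncl f p q h ⟨w, e⟩ z).2.1,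
      (fiberIncl f p q h ⟨w, e⟩ z).2.2, k', hk', c, j, ?_, ?_⟩
    · exact (pushout.inl_desc_assoc _ _ _ _).symm.trans
        ((congrArg (pushout.inl _ _ ≫ ·) h1).trans (pushout.inl_desc_assoc _ _ _ _))
    · exact (pushout.inr_desc_assoc _ _ _ _).symm.trans
        ((congrArg (pushout.inr _ _ ≫ ·) h1).trans (pushout.inr_desc_assoc _ _ _ _))
  -- Schematicity of `f_p` gives a larger `x` with `𝒴_{pq}(w.2) ≤ f_p(x)`; then schematicity of
  -- `𝒴_{pq}` gives a larger `y` with `f_p(x) ≤ 𝒴_{pq}(y)`. The field point follows through two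
  -- extensions.
  · obtain ⟨⟨x, hx, hx'⟩, k₁, _, c₁, j₁, ha, hb⟩ := (comap_tensorToProd_surjective_iff _ _ _ _ _
      _).1 (hf p w.1 _ hw) k a ((Y.trans h).sharp w.2 ≫ b) (hab.trans (Category.assoc _ _ _))
    obtain ⟨⟨y, hy, hy'⟩, k₂, _, c₂, j₂, ha', hb'⟩ := (comap_tensorToProd_surjective_iff _ _ _ _ _
      _).1 (hY.trans h w.2 _ hx') k₁ (b ≫ j₁) ((component f p).sharp x ≫ c₁)
      ((Category.assoc _ _ _).symm.trans (hb.symm.trans (Category.assoc _ _ _)))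
    -- If the pair had not moved, the inequality after the first move would be the reverse of `hw`,
    -- contradicting `e`.
    have hlt : w < (x, y) := lt_of_le_of_ne ⟨hx, hy⟩ fun hwx => by
      subst hwx
      exact e (le_antisymm hw hx')
    obtain ⟨z, hz, hz', k₃, hk₃, c₃, j₃, h1, h2⟩ := IH (x, y) hlt hy' k₂ (c₁ ≫ j₂) c₂
      ((Category.assoc _ _ _).symm.trans hb'.symm)
    have e1 : (X.stalk p).unop.res hx ≫ (c₁ ≫ j₂) ≫ j₃ = a ≫ j₁ ≫ j₂ ≫ j₃ := by
      simpa only [Category.assoc] using congrArg (· ≫ j₂ ≫ j₃) ha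
    have e2 : (Y.stalk q).unop.res hy ≫ c₂ ≫ j₃ = b ≫ j₁ ≫ j₂ ≫ j₃ := by
      simpa only [Category.assoc] using congrArg (· ≫ j₃) ha'
    have hle : (⟨p, w.1⟩ : CylPt X) ≤ ⟨p, x⟩ := ⟨le_rfl, by rw [trans_refl]; exact hx⟩
    have hle' : (⟨q, w.2⟩ : CylPt Y) ≤ ⟨q, y⟩ := ⟨le_rfl, by rw [trans_refl]; exact hy⟩
    refine ⟨z, hle.trans hz, hle'.trans hz', k₃, hk₃, c₃, j₁ ≫ j₂ ≫ j₃, ?_, ?_⟩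
    · refine (congrArg (· ≫ c₃) ((res_res (cyl X) hle hz).symm.trans
        (congrArg (· ≫ _) (cyl_res_of_idx_eq p hx hle)))).trans ?_
      refine (Category.assoc _ _ _).trans ((congrArg (_ ≫ ·) h1).trans e1)
    · refine (congrArg (· ≫ c₃) ((res_toLE (cylMap f) hle' hz').symm.trans
        (congrArg (· ≫ _) (cyl_res_of_idx_eq q hy hle')))).trans ?_
      refine (Category.assoc _ _ _).trans ((congrArg (_ ≫ ·) h2).trans e2)

theorem isSchematicHom_cylMap (hY : Y.IsSchFin) (hf : IsSchFinHom f)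
    (hq : ∀ (p : X) (q : Y) (h : f.base p ≤ q), IsQcIso (rho f p q h)) :
    IsSchematicHom (cylMap f) := fun x y hxy => by
  rw [comap_tensorToProd_surjective_iff]
  intro k _ s t hst
  obtain ⟨z, hz, hz', k', hk', c, j, h1, h2⟩ := exists_field_cyl f x.idx y.idx hxy.1 hY hf
    (hq _ _ _) (x.pt, y.pt) hxy.2 k s t hst
  exact ⟨⟨z, hz, hz'⟩, k', hk', c, j, h1, h2⟩

end RingedPosetData

theorem mainTheorem10 (X Y : RingedPosetData.{u}) (hX : X.IsSchFin) (hY : Y.IsSchFin)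
    (f : X ⟶ Y) (hf : RingedPosetData.IsSchFinHom f)
    (hcX : RingedPoset.IsSchematic (CData.cyl X)) (hcY : RingedPoset.IsSchematic (CData.cyl Y)) :
    RingedPoset.IsSchematicHom (CData.cylMap f) ↔
      ∀ (p : X) (q : Y) (h : f.base p ≤ q), RingedPoset.IsQcIso (CData.rho f p q h) :=
  ⟨fun hs p q h => RingedPosetData.isQcIso_rho f p q h hX hY hcX hcY hs,
    RingedPosetData.isSchematicHom_cylMap f hY hf⟩
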